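/- For every $n \ge 0$ let $\pi_n$ be a permutation of $\{0,1\}^n$, and let $\pi:\{0,1\}^*\to\{0,1\}^*$ be the length-preserving function that acts as $\pi_n$ on $\{0,1\}^n$. The permutation oracle of $\pi$ is the Boolean function on $\{0,1\}^*$ that gives, on the code $1^i0x$ of a pair $(x,i)$, the bit of index $i$ of $\pi(x)$ (counted from $0$), and that is $0$ if there is no such bit and on strings that are not codes. The oracle is random when the $\pi_n$ are independent and each $\pi_n$ is uniformly distributed among the permutations of $\{0,1\}^n$. An oracle machine (deterministic or quantum) has finitely many two-way infinite tapes over the alphabet $\{0,1,\text{blank}\}$, one of them a query tape. Whenever it is in its pre-query state, it takes one step to its post-query state, in which a query tape whose non-blank cells form one block $x\circ b$ ($x\in\{0,1\}^*$, $b\in\{0,1\}$) is changed to $x\circ(b\oplus A(x))$, $A$ being the oracle; a blank (or fragmented) query tape does not change. A quantum machine is given by transition amplitudes whose real and imaginary parts can be approximated to within $2^{-n}$ in deterministic time polynomial in $n$, and it is well-formed if its time evolution preserves the Euclidean norm. It halts at time $t$ if at time $t$ its superposition contains only configurations in the final state and at no earlier time contains any such configuration. **Corollary 3.7.** With probability $1$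 over a random permutation oracle, the function $\pi$ is a quantum one-way permutation relative to the oracle, in the following sense. $\pi$ is a length-preserving permutation of $\{0,1\}^*$, and: 1. $\pi$ is computed in polynomial time by a deterministic classical Turing machine that has access to the oracle; the machine and the polynomial do not depend on $\pi$. 2. Inverting $\pi$ takes time $\Omega(2^{n/3})$ on a quantum machine with access to the oracle: if $M$ is a well-formed oracle quantum Turing machine and $T:\mathbb N\to\mathbb N$ is such that for every $x$, on input $\pi(x)$ of length $n$, $M$ halts within $T(n)$ steps and its final superposition, when observed, gives the output $x$ with probability at least $2/3$, then there is a constant $c>0$ such that $T(n)\ge c\,2^{n/3}$ for all sufficiently large $n$. -/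

import Mathlib

open MeasureTheory

noncomputable section

namespace OracleTM

/-! ### Tapes -/

/-- The tape alphabet: a blank, and the two bits. -/
inductive Sym where
  | blank : Sym
  | bit : Bool → Sym
  deriving DecidableEq, Fintype

instance : Zero Sym := ⟨Sym.blank⟩

/-- A two-way infinite tape, all but finitely many cells of which are blank. -/
abbrev Tape := ℤ →₀ Sym

/-- The content of cell `z` when the word `w` is written from cell `a` on. -/
def wordCell (a : ℤ) (w : List Bool) (z : ℤ) : Sym :=
  if a ≤ z then (w[(z - a).toNat]?).elim Sym.blank Sym.bit else Sym.blank

/-- The tape that holds the word `w` in the cells `a, a + 1, …, a + |w| - 1` and is blank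
elsewhere. -/
def wordTape (a : ℤ) (w : List Bool) : Tape :=
  Finsupp.onFinset (Finset.Ico a (a + w.length)) (wordCell a w) (by
    intro z hz
    rw [Finset.mem_Ico]
    by_cases h : a ≤ z
    · refine ⟨h, ?_⟩
      by_contra h2
      apply hz
      have h3 : w[(z - a).toNat]? = none := by
        rw [List.getElem?_eq_none_iff]
        omega
      simp only [wordCell, h, h3, if_true, Option.elim_none]
      rfl
    · exact absurd (by simp only [wordCell, h, if_false]; rfl) hz)

/-- The tape is blank except for one contiguous block, which spells `w`. -/
def Holds (t : Tape) (w : List Bool) : Prop := ∃ a : ℤ, t = wordTape a w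

/-- A Boolean oracle. -/
abbrev Oracle := List Bool → Bool

open Classical in
/-- The effect of a call to the oracle `A` on the query tape: if the tape holds a single nonempty
block `x ∘ b`, then that block is replaced by `x ∘ (b ⊕ A x)` (the data `a`, `x`, `b` are determined
by the tape); otherwise, in particular if the tape is blank, nothing happens. -/
def callTape (A : Oracle) (t : Tape) : Tape :=
  if h : ∃ q : ℤ × List Bool × Bool, t = wordTape q.1 (q.2.1 ++ [q.2.2]) then
    wordTape h.choose.1 (h.choose.2.1 ++ [xor h.choose.2.2 (A h.choose.2.1)])
  else t

/-! ### Machines with a query tape -/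

/-- A head movement. -/
inductive Move where
  | left : Move
  | stay : Move
  | right : Move
  deriving DecidableEq

instance : Fintype Move :=
  ⟨{Move.left, Move.stay, Move.right}, fun m => by cases m <;> decide⟩

/-- The displacement of a head. -/
def Move.shift : Move → ℤ
  | Move.left => -1
  | Move.stay => 0
  | Move.right => 1

/-- The data common to deterministic and quantum oracle machines: finitely many states, with the
initial, final, pre-query and post-query ones distinguished, and `work + 2` tapes. Tape `0` holds the
input, tape `1` is the query tape, and the output is read from tape `out`. -/
structure Frame where
  states : ℕ
  work : ℕ
  start : Fin states
  final : Fin states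
  query : Fin states
  answer : Fin states
  out : Fin (work + 2)
  start_ne_final : start ≠ final
  query_ne_answer : query ≠ answer

/-- The symbols under the heads (or to be written by the heads). -/
abbrev Frame.Scan (F : Frame) := Fin (F.work + 2) → Sym

/-- What a machine does in one step: a new state, and for every tape a symbol to write and a
movement. -/
abbrev Frame.Action (F : Frame) := Fin F.states × F.Scan × (Fin (F.work + 2) → Move)

/-- A configuration. -/
structure Config (F : Frame) where
  state : Fin F.states
  tape : Fin (F.work + 2) → Tape
  head : Fin (F.work + 2) → ℤ

variable {F : Frame}

/-- The symbols under the heads. -/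
def Config.scan (c : Config F) : F.Scan := fun j => c.tape j (c.head j)

/-- The configuration after an action. -/
def Config.act (c : Config F) (a : F.Action) : Config F where
  state := a.1
  tape := fun j => (c.tape j).update (c.head j) (a.2.1 j)
  head := fun j => c.head j + (a.2.2 j).shift

/-- The configuration after a call to the oracle: control passes to the post-query state, the query
tape changes, and nothing else does. -/
def Config.call (A : Oracle) (c : Config F) : Config F where
  state := F.answer
  tape := Function.update c.tape 1 (callTape A (c.tape 1))
  head := c.head

/-- The initial configuration on input `x`: `x` stands on tape `0` from cell `0` on, all other cells
are blank, all heads are on cell `0`. -/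
def Config.init (F : Frame) (x : List Bool) : Config F where
  state := F.start
  tape := fun j => if j = 0 then wordTape 0 x else 0
  head := fun _ => 0

/-- The output tape holds `w`. -/
def Config.Outputs (c : Config F) (w : List Bool) : Prop := Holds (c.tape F.out) w

/-! ### Deterministic oracle machines -/

/-- A deterministic oracle Turing machine. -/
structure DetMachine extends Frame where
  delta : Fin states → toFrame.Scan → toFrame.Action

namespace DetMachine

/-- One step; a query costs one step. -/
def step (M : DetMachine) (A : Oracle) (c : Config M.toFrame) : Config M.toFrame :=
  if c.state = M.query then c.call A else c.act (M.delta c.state c.scan)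

/-- The configuration at time `t` on input `x`. -/
def run (M : DetMachine) (A : Oracle) (x : List Bool) (t : ℕ) : Config M.toFrame :=
  (M.step A)^[t] (Config.init M.toFrame x)

/-- The machine is in the final state at time `t`, and not earlier. -/
def HaltsAt (M : DetMachine) (A : Oracle) (x : List Bool) (t : ℕ) : Prop :=
  (M.run A x t).state = M.final ∧ ∀ s < t, (M.run A x s).state ≠ M.final

/-- With oracle `A`, the machine computes `f`, in at most `T n` steps on each input of length `n`. -/
def ComputesInTime (M : DetMachine) (A : Oracle) (f : List Bool → List Bool) (T : ℕ → ℕ) : Prop :=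
  ∀ x, ∃ t ≤ T x.length, M.HaltsAt A x t ∧ (M.run A x t).Outputs (f x)

end DetMachine

/-! ### Amplitudes -/

/-- The dyadic rational `± k / 2 ^ n` named by a word: a sign bit, and then the binary digits of `k`,
the least significant one first. -/
def dyadic (n : ℕ) : List Bool → ℝ
  | [] => 0
  | s :: w => (if s then -1 else 1) * (Nat.ofDigits 2 (w.map Bool.toNat) : ℕ) / 2 ^ n

/-- Real numbers that can be approximated to within `2 ^ (-n)` in deterministic time polynomial in
`n` (no oracle: the oracle that is constantly `0`). -/
def PolyTimeReal (r : ℝ) : Prop :=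
  ∃ (M : DetMachine) (f : List Bool → List Bool) (p : Polynomial ℕ),
    M.ComputesInTime (fun _ => false) f (fun n => p.eval n) ∧
    ∀ n : ℕ, |r - dyadic n (f (List.replicate n true))| ≤ 1 / 2 ^ n

/-- The complex numbers that are allowed as transition amplitudes. -/
def Amplitudes : Set ℂ := {z | PolyTimeReal z.re ∧ PolyTimeReal z.im}

/-! ### Quantum oracle machines -/

/-- An oracle quantum Turing machine, given by its quantum transition function. -/
structure QuantumMachine extends Frame where
  amp : Fin states → toFrame.Scan → toFrame.Action → ℂ
  amp_mem : ∀ q s a, amp q s a ∈ Amplitudes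

/-- Superpositions of configurations. -/
abbrev Superposition (F : Frame) := Config F →₀ ℂ

/-- The sum of the squared magnitudes of the configurations that satisfy `P`. -/
def weight (φ : Superposition F) (P : Config F → Prop) : ℝ :=
  open Classical in φ.sum fun c z => if P c then ‖z‖ ^ 2 else 0

namespace QuantumMachine

/-- The superposition one step after a configuration; a query costs one step. -/
def stepConfig (M : QuantumMachine) (A : Oracle) (c : Config M.toFrame) :
    Superposition M.toFrame :=
  if c.state = M.query then Finsupp.single (c.call A) 1
  else ∑ a : M.toFrame.Action, Finsupp.single (c.act a) (M.amp c.state c.scan a)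

/-- The time evolution operator with oracle `A`: the linear extension of `stepConfig`. -/
def evolve (M : QuantumMachine) (A : Oracle) :
    Superposition M.toFrame →ₗ[ℂ] Superposition M.toFrame :=
  Finsupp.linearCombination ℂ (M.stepConfig A)

/-- The machine is well-formed: time evolution preserves the Euclidean norm. (As an oracle call
permutes the configurations of the query tape, this does not depend on the oracle.) -/
def WellFormed (M : QuantumMachine) : Prop :=
  ∀ (A : Oracle) (φ : Superposition M.toFrame),
    weight (M.evolve A φ) (fun _ => True) = weight φ (fun _ => True)

/-- The superposition at time `t` on input `x`. -/
def run (M : QuantumMachine) (A : Oracle) (x : List Bool) (t : ℕ) : Superposition M.toFrame :=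
  (M.evolve A)^[t] (Finsupp.single (Config.init M.toFrame x) 1)

/-- At time `t` the superposition contains only final configurations, and at any earlier time it
contains none. -/
def HaltsAt (M : QuantumMachine) (A : Oracle) (x : List Bool) (t : ℕ) : Prop :=
  (∀ c ∈ (M.run A x t).support, c.state = M.final) ∧
    ∀ s < t, ∀ c ∈ (M.run A x s).support, c.state ≠ M.final

/-- With oracle `A`, the machine inverts `f`, in at most `T n` steps on each input of length `n`:
on input `f x` it halts in time, and observing the final superposition then yields the output `x`
with probability at least `2 / 3`. -/
def InvertsInTime (M : QuantumMachine) (A : Oracle) (f : List Bool → List Bool) (T : ℕ → ℕ) :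
    Prop :=
  ∀ x, ∃ t ≤ T (f x).length, M.HaltsAt A (f x) t ∧
    2 / 3 ≤ weight (M.run A (f x) t) (fun c => c.Outputs x)

end QuantumMachine

/-! ### Random permutation oracles -/

/-- A permutation of `{0,1} ^ n` for every `n`. -/
abbrev Permutations := (n : ℕ) → Equiv.Perm (Fin n → Bool)

/-- The length-preserving function `{0,1}* → {0,1}*` given by a family of permutations. -/
def Permutations.toFun (π : Permutations) (x : List Bool) : List Bool :=
  List.ofFn (π x.length x.get)

/-- The pairing function: `(x, i)` is encoded as `1 ^ i 0 x`. -/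
def pair (x : List Bool) (i : ℕ) : List Bool := List.replicate i true ++ false :: x

/-- The permutation oracle of a family of permutations, as a Boolean function: on the code of
`(x, i)` it gives the bit of index `i` (counted from `0`) of the image of `x`, see `oracle_pair`; it
is `0` if there is no such bit, and on strings that are not codes. -/
def Permutations.oracle (π : Permutations) : Oracle := fun w =>
  ((π.toFun (w.dropWhile id).tail)[(w.takeWhile id).length]?).getD false

theorem oracle_pair (π : Permutations) (x : List Bool) (i : ℕ) :
    π.oracle (pair x i) = ((π.toFun x)[i]?).getD false := by
  have h1 : (pair x i).takeWhile id = List.replicate i true := by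
    induction i with
    | zero => simp [pair]
    | succ k ih => simp [pair]
  have h2 : (pair x i).dropWhile id = false :: x := by
    simp [pair]
  simp [Permutations.oracle, h1, h2]

instance (n : ℕ) : MeasurableSpace (Equiv.Perm (Fin n → Bool)) := ⊤

/-- The law of a random permutation oracle: independently for every `n`, a uniformly distributed
permutation of `{0,1} ^ n`. -/
def randomPermutations : Measure Permutations :=
  Measure.infinitePi fun n => (PMF.uniformOfFintype (Equiv.Perm (Fin n → Bool))).toMeasure

end OracleTM

end

/-!
For the lower bound, fix a well-formed machine `M`, a time `τ`, a word `y` of length `n`, and all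
`π k` with `k ≠ n`. If `M` finds the preimages `u ≠ v` of `y` under two permutations that agree
outside `u`, `v` and one more point `c`, then its two runs on `y` end far apart, and by the hybrid
argument of Bennett, Bernstein, Brassard and Vazirani it must query `v` or `c` heavily in the first
run or `u` in the second one. As `M` is well-formed, a run has at most `O(τ²)` heavy words.

Moving the preimage of a given `y` to a uniformly random place `z` turns a uniformly random
permutation into another one. Two choices of `z` give permutations of the above kind, so `M` rarely
succeeds for both; by Cauchy–Schwarz the square of its success probability is `O(τ² / 2 ^ n)`. For
`τ = 2 ^ (n / 3)` the success probability is `O(2 ^ (-n / 6))`, which is summable. So Borel–Cantelli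
applies to each of the machines, and there are only countably many of them, because there are only
countably many computable amplitudes.
-/

namespace OracleTM

/-! ### Moving a value of a permutation -/

section DoubleCounting

open Finset

variable {Ω X : Type*} [Fintype X]

theorem sum_card_filter_equiv [Fintype Ω] (e : Ω × X ≃ Ω × X) (Q : Ω × X → Prop)
    [DecidablePred Q] :
    ∑ ω, #{z | Q (e (ω, z))} = ∑ ω, #{z | Q (ω, z)} := by
  simp only [card_filter, ← Fintype.sum_prod_type' (fun ω z => if Q (e (ω, z)) then 1 else 0),
    ← Fintype.sum_prod_type' (fun ω z => if Q (ω, z) then 1 else 0)]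
  exact e.sum_comp fun p => if Q p then 1 else 0

theorem sq_card_mul_card_le_card_mul_sum [Fintype Ω] [DecidableEq Ω] (e : Ω × X ≃ Ω × X)
    (S : Finset Ω) :
    (Fintype.card X * #S) ^ 2 ≤
      Fintype.card Ω * ∑ ω, #{z | (e (ω, z)).1 ∈ S} ^ 2 := by
  have total : ∑ ω, #{z | (e (ω, z)).1 ∈ S} = Fintype.card X * #S := by
    rw [sum_card_filter_equiv e fun p => p.1 ∈ S]
    simp only [card_filter]
    rw [sum_comm]
    simp
  rw [← total]
  exact sq_sum_le_card_mul_sum_sq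

variable {S : Finset Ω} {B : Ω → Finset X} {b : ℕ}

theorem sq_card_filter_le [DecidableEq Ω] [DecidableEq X] {f : X → Ω × X} (hB : ∀ ω, #(B ω) ≤ b)
    (hS : ∀ z z', z ≠ z' → (f z).1 ∈ S → (f z').1 ∈ S →
      z' ∈ B (f z).1 ∨ z ∈ B (f z').1 ∨ (f z).2 ∈ B (f z).1) :
    #{z | (f z).1 ∈ S} ^ 2 ≤
      Fintype.card X * (1 + 2 * b + #{z | (f z).2 ∈ B (f z).1}) := by
  have row (z : X) : #{z' | z' ∈ B (f z).1} ≤ b := by simpa using hB (f z).1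
  calc #{z | (f z).1 ∈ S} ^ 2
      = ∑ z, ∑ z', if (f z).1 ∈ S ∧ (f z').1 ∈ S then 1 else 0 := by
        simp only [card_filter, sq, sum_mul_sum, ite_and, ite_mul, one_mul, zero_mul]
    _ ≤ ∑ z, ∑ z', ((if z' = z then 1 else 0) + (if z' ∈ B (f z).1 then 1 else 0)
          + (if z ∈ B (f z').1 then 1 else 0)
          + (if (f z).2 ∈ B (f z).1 then 1 else 0)) := by
        gcongr with z _ z' _
        have := hS z z'
        split_ifs <;> grind
    _ = ∑ _z : X, 1 + ∑ z, #{z' | z' ∈ B (f z).1} + ∑ z', #{z | z ∈ B (f z').1}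
          + Fintype.card X * #{z | (f z).2 ∈ B (f z).1} := by
        rw [card_filter, mul_sum]
        simp only [sum_add_distrib, card_filter, sum_const, card_univ, smul_eq_mul, sum_ite_eq',
          mem_univ, if_true]
        rw [sum_comm (f := fun z z' => if z ∈ B (f z').1 then 1 else 0)]
    _ ≤ ∑ _z : X, 1 + ∑ _z : X, b + ∑ _z : X, b
          + Fintype.card X * #{z | (f z).2 ∈ B (f z).1} := by
        gcongr <;> exact row _
    _ = _ := by
        simp only [sum_const, card_univ, smul_eq_mul]
        ring

theorem sq_card_mul_card_le [Fintype Ω] {e : Ω × X ≃ Ω × X} (hB : ∀ ω, #(B ω) ≤ b)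
    (hS : ∀ ω z z', z ≠ z' → (e (ω, z)).1 ∈ S → (e (ω, z')).1 ∈ S →
      z' ∈ B (e (ω, z)).1 ∨ z ∈ B (e (ω, z')).1 ∨ (e (ω, z)).2 ∈ B (e (ω, z)).1) :
    #S ^ 2 * Fintype.card X ≤ Fintype.card Ω ^ 2 * (3 * b + 1) := by
  classical
  obtain hX | hX := (Fintype.card X).eq_zero_or_pos
  · simp [hX]
  have diagonal : ∑ ω, #{z | (e (ω, z)).2 ∈ B (e (ω, z)).1} ≤ Fintype.card Ω * b := by
    rw [sum_card_filter_equiv e fun p => p.2 ∈ B p.1]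
    simpa using sum_le_card_nsmul univ (fun ω => #(B ω)) b fun ω _ => hB ω
  refine Nat.le_of_mul_le_mul_left ?_ hX
  calc Fintype.card X * (#S ^ 2 * Fintype.card X) = (Fintype.card X * #S) ^ 2 := by ring
    _ ≤ Fintype.card Ω * ∑ ω, #{z | (e (ω, z)).1 ∈ S} ^ 2 := sq_card_mul_card_le_card_mul_sum e S
    _ ≤ Fintype.card Ω *
          ∑ ω, Fintype.card X * (1 + 2 * b + #{z | (e (ω, z)).2 ∈ B (e (ω, z)).1}) := by
        gcongr with ω
        exact sq_card_filter_le hB (hS ω)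
    _ = Fintype.card Ω * (Fintype.card X * (Fintype.card Ω * (1 + 2 * b)
          + ∑ ω, #{z | (e (ω, z)).2 ∈ B (e (ω, z)).1})) := by
        rw [← mul_sum, sum_add_distrib, sum_const, card_univ, smul_eq_mul]
    _ ≤ Fintype.card Ω * (Fintype.card X * (Fintype.card Ω * (1 + 2 * b)
          + Fintype.card Ω * b)) := by
        gcongr
    _ = _ := by ring

end DoubleCounting

section MoveTo

variable {X : Type*} [DecidableEq X]

/-- The permutation that takes the value `y` at `z`, obtained from `π` by exchanging two values. -/
def moveTo (y : X) (π : Equiv.Perm X) (z : X) : Equiv.Perm X :=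
  π * Equiv.swap (π.symm y) z

theorem moveTo_symm_apply (y : X) (π : Equiv.Perm X) (z : X) : (moveTo y π z).symm y = z := by
  rw [Equiv.symm_apply_eq]
  simp [moveTo]

theorem moveTo_apply_of_ne {y z x : X} {π : Equiv.Perm X} (hx : x ≠ π.symm y) (hxz : x ≠ z) :
    moveTo y π z x = π x := by
  simp [moveTo, Equiv.swap_apply_of_ne_of_ne hx hxz]

theorem moveTo_moveTo (y : X) (π : Equiv.Perm X) (z : X) :
    moveTo y (moveTo y π z) (π.symm y) = π := by
  rw [moveTo, moveTo_symm_apply, moveTo, mul_assoc, Equiv.swap_comm, Equiv.swap_mul_self, mul_one]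

/-- The involution `(π, z) ↦ (moveTo y π z, π⁻¹ y)` of pairs of a permutation and a point. -/
def moveToEquiv (y : X) : Equiv.Perm X × X ≃ Equiv.Perm X × X :=
  Function.Involutive.toPerm (fun p => (moveTo y p.1 p.2, p.1.symm y)) fun p => by
    simp only [moveTo_moveTo, moveTo_symm_apply]

theorem moveToEquiv_apply (y : X) (π : Equiv.Perm X) (z : X) :
    moveToEquiv y (π, z) = (moveTo y π z, π.symm y) :=
  rfl

variable [Fintype X]

theorem sq_card_perm_mul_card_le (y : X) (S : Finset (Equiv.Perm X)) {B : Equiv.Perm X → Finset X}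
    {b : ℕ} (hB : ∀ ρ, (B ρ).card ≤ b)
    (hS : ∀ ρ ∈ S, ∀ ρ' ∈ S, ∀ c, ρ.symm y ≠ ρ'.symm y →
      (∀ x, x ≠ ρ.symm y → x ≠ ρ'.symm y → x ≠ c → ρ x = ρ' x) →
      ρ'.symm y ∈ B ρ ∨ ρ.symm y ∈ B ρ' ∨ c ∈ B ρ) :
    S.card ^ 2 * Fintype.card X ≤ Fintype.card (Equiv.Perm X) ^ 2 * (3 * b + 1) := by
  refine sq_card_mul_card_le (e := moveToEquiv y) hB fun π z z' hz hzS hz'S => ?_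
  have agree (x) (hxz : x ≠ z) (hxz' : x ≠ z') (hx : x ≠ π.symm y) :
      moveTo y π z x = moveTo y π z' x := by
    rw [moveTo_apply_of_ne hx hxz, moveTo_apply_of_ne hx hxz']
  have := hS _ hzS _ hz'S (π.symm y)
  simp only [moveToEquiv_apply, moveTo_symm_apply] at this ⊢
  exact this hz agree

end MoveTo

/-! ### Query weights and hybrids -/

section Words

theorem wordTape_apply_ne_blank (a : ℤ) (w : List Bool) (z : ℤ) :
    wordTape a w z ≠ Sym.blank ↔ a ≤ z ∧ z < a + w.length := by
  change wordCell a w z ≠ Sym.blank ↔ _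
  unfold wordCell
  split_ifs with h
  · rcases lt_or_ge (z - a).toNat w.length with hz | hz
    · simp only [List.getElem?_eq_getElem hz, Option.elim_some, ne_eq, reduceCtorEq,
        not_false_eq_true, true_iff]
      omega
    · simp only [List.getElem?_eq_none hz, Option.elim_none, ne_eq, not_true_eq_false, false_iff]
      omega
  · simp only [ne_eq, not_true_eq_false, false_iff]
    omega

theorem wordTape_apply_add (a : ℤ) (w : List Bool) (i : ℕ) (hi : i < w.length) :
    wordTape a w (a + i) = Sym.bit w[i] := by
  change wordCell a w (a + i) = _
  simp [wordCell, hi]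

theorem wordTape_injective {a a' : ℤ} {w w' : List Bool} (h : wordTape a w = wordTape a' w') :
    w = w' ∧ (w ≠ [] → a = a') := by
  have block (z : ℤ) : (a ≤ z ∧ z < a + w.length) ↔ (a' ≤ z ∧ z < a' + w'.length) := by
    rw [← wordTape_apply_ne_blank, h, wordTape_apply_ne_blank]
  have hfirst := block a
  have hfirst' := block a'
  have hlast := block (a + w.length - 1)
  have hlast' := block (a' + w'.length - 1)
  have start_eq (hw : 0 < w.length) : a = a' := by omega
  refine ⟨List.ext_getElem (by omega) fun i hi hi' => ?_,
    fun hw => start_eq (List.length_pos_of_ne_nil hw)⟩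
  obtain rfl := start_eq (by omega)
  have := DFunLike.congr_fun h (a + i)
  rw [wordTape_apply_add _ _ _ hi, wordTape_apply_add _ _ _ hi'] at this
  exact Sym.bit.inj this

theorem Holds.unique {t : Tape} {w w' : List Bool} (h : Holds t w) (h' : Holds t w') : w = w' := by
  obtain ⟨a, rfl⟩ := h
  obtain ⟨a', h'⟩ := h'
  exact (wordTape_injective h').1

theorem wordTape_concat_injective {a a' : ℤ} {w w' : List Bool} {b b' : Bool}
    (h : wordTape a (w ++ [b]) = wordTape a' (w' ++ [b'])) : a = a' ∧ w = w' ∧ b = b' := by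
  obtain ⟨hw, ha⟩ := wordTape_injective h
  obtain ⟨hw, hb⟩ := List.append_inj' hw rfl
  exact ⟨ha (by simp), hw, List.singleton_inj.1 hb⟩

theorem callTape_wordTape (A : Oracle) (a : ℤ) (x : List Bool) (b : Bool) :
    callTape A (wordTape a (x ++ [b])) = wordTape a (x ++ [xor b (A x)]) := by
  have h : ∃ q : ℤ × List Bool × Bool,
      wordTape a (x ++ [b]) = wordTape q.1 (q.2.1 ++ [q.2.2]) := ⟨(a, x, b), rfl⟩
  rw [callTape, dif_pos h]
  obtain ⟨ha, hx, hb⟩ := wordTape_concat_injective h.choose_spec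
  rw [← ha, ← hx, ← hb]

theorem callTape_of_forall_ne (A : Oracle) {t : Tape}
    (h : ∀ a x b, t ≠ wordTape a (x ++ [b])) : callTape A t = t := by
  rw [callTape, dif_neg]
  rintro ⟨q, hq⟩
  exact h _ _ _ hq

end Words

variable {F : Frame}

section Weights

/-- The squared Euclidean norm of a superposition. -/
noncomputable def normSq (φ : Superposition F) : ℝ := weight φ fun _ => True

open Classical in
theorem weight_eq_sum (φ : Superposition F) (P : Config F → Prop) {s : Finset (Config F)}
    (hs : φ.support ⊆ s) : weight φ P = ∑ c ∈ s, if P c then ‖φ c‖ ^ 2 else 0 :=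
  Finsupp.sum_of_support_subset φ hs _ (by simp)

theorem normSq_eq_sum (φ : Superposition F) {s : Finset (Config F)} (hs : φ.support ⊆ s) :
    normSq φ = ∑ c ∈ s, ‖φ c‖ ^ 2 := by
  rw [normSq, weight_eq_sum φ _ hs]
  simp

theorem weight_nonneg (φ : Superposition F) (P : Config F → Prop) : 0 ≤ weight φ P := by
  classical
  rw [weight_eq_sum φ P subset_rfl]
  exact Finset.sum_nonneg fun c _ => by positivity

theorem weight_mono (φ : Superposition F) {P Q : Config F → Prop} (h : ∀ c, P c → Q c) :
    weight φ P ≤ weight φ Q := by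
  classical
  rw [weight_eq_sum φ P subset_rfl, weight_eq_sum φ Q subset_rfl]
  gcongr with c
  by_cases hP : P c
  · simp [hP, h c hP]
  · rw [if_neg hP]
    positivity

theorem weight_le_normSq (φ : Superposition F) (P : Config F → Prop) : weight φ P ≤ normSq φ :=
  weight_mono φ fun _ _ => trivial

theorem weight_eq_normSq {φ : Superposition F} {P : Config F → Prop} (h : ∀ c ∈ φ.support, P c) :
    weight φ P = normSq φ := by
  classical
  rw [weight_eq_sum φ P subset_rfl, normSq_eq_sum φ subset_rfl]
  exact Finset.sum_congr rfl fun c hc => if_pos (h c hc)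

theorem weight_eq_zero {φ : Superposition F} {P : Config F → Prop} (h : ∀ c ∈ φ.support, ¬ P c) :
    weight φ P = 0 := by
  classical
  rw [weight_eq_sum φ P subset_rfl]
  exact Finset.sum_eq_zero fun c hc => if_neg (h c hc)

theorem weight_add_weight_not (φ : Superposition F) (P : Config F → Prop) :
    weight φ P + weight φ (fun c => ¬ P c) = normSq φ := by
  classical
  simp only [weight_eq_sum φ _ subset_rfl, normSq_eq_sum φ subset_rfl, ← Finset.sum_add_distrib]
  refine Finset.sum_congr rfl fun c _ => ?_
  by_cases hP : P c <;> simp [hP]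

theorem weight_or_le (φ : Superposition F) (P Q : Config F → Prop) :
    weight φ (fun c => P c ∨ Q c) ≤ weight φ P + weight φ Q := by
  classical
  simp only [weight_eq_sum φ _ subset_rfl, ← Finset.sum_add_distrib]
  gcongr with c
  have := sq_nonneg ‖φ c‖
  split_ifs <;> grind

theorem sum_weight_le_normSq {ι : Type*} (s : Finset ι) (φ : Superposition F)
    {P : ι → Config F → Prop} (hP : ∀ c, ∀ i ∈ s, ∀ j ∈ s, P i c → P j c → i = j) :
    ∑ i ∈ s, weight φ (P i) ≤ normSq φ := by
  classical
  simp only [weight_eq_sum φ _ subset_rfl, normSq_eq_sum φ subset_rfl]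
  rw [Finset.sum_comm]
  gcongr with c
  rw [← Finset.sum_filter, Finset.sum_const, nsmul_eq_mul]
  refine mul_le_of_le_one_left (sq_nonneg _) (mod_cast Finset.card_le_one.2 fun i hi j hj => ?_)
  rw [Finset.mem_filter] at hi hj
  exact hP c i hi.1 j hj.1 hi.2 hj.2

theorem normSq_filter (φ : Superposition F) (P : Config F → Prop) [DecidablePred P] :
    normSq (φ.filter P) = weight φ P := by
  rw [weight_eq_sum φ P subset_rfl, normSq_eq_sum (φ.filter P) (s := φ.support)
    (by simp [Finsupp.support_filter])]
  refine Finset.sum_congr rfl fun c _ => ?_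
  by_cases hP : P c <;> simp [hP]

theorem normSq_single (c : Config F) (z : ℂ) : normSq (Finsupp.single c z) = ‖z‖ ^ 2 := by
  classical
  rw [normSq_eq_sum _ Finsupp.support_single_subset]
  simp

theorem normSq_sub_comm (φ ψ : Superposition F) : normSq (φ - ψ) = normSq (ψ - φ) := by
  rw [← neg_sub ψ φ, normSq_eq_sum (-(ψ - φ)) (Finsupp.support_neg _).le,
    normSq_eq_sum _ subset_rfl]
  simp only [Finsupp.neg_apply, norm_neg]

theorem weight_add_le (φ ψ : Superposition F) (P : Config F → Prop) {ε : ℝ} (hε : 0 < ε) :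
    weight (φ + ψ) P ≤ (1 + ε) * weight φ P + (1 + ε⁻¹) * weight ψ P := by
  classical
  rw [weight_eq_sum _ P Finsupp.support_add,
    weight_eq_sum φ P (Finset.subset_union_left (s₂ := ψ.support)),
    weight_eq_sum ψ P (Finset.subset_union_right (s₁ := φ.support)),
    Finset.mul_sum, Finset.mul_sum, ← Finset.sum_add_distrib]
  gcongr with c
  split_ifs
  · calc ‖(φ + ψ) c‖ ^ 2 ≤ (‖φ c‖ + ‖ψ c‖) ^ 2 := by
          gcongr
          exact norm_add_le _ _
      _ = ‖φ c‖ ^ 2 + 2 * ‖φ c‖ * ‖ψ c‖ + ‖ψ c‖ ^ 2 := by ring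
      _ ≤ ‖φ c‖ ^ 2 + (ε * ‖φ c‖ ^ 2 + ε⁻¹ * ‖ψ c‖ ^ 2) + ‖ψ c‖ ^ 2 := by
          gcongr
          exact two_mul_le_add_mul_sq hε
      _ = _ := by ring
  · simp

theorem normSq_sub_le (φ ψ χ : Superposition F) :
    normSq (φ - ψ) ≤ 2 * normSq (φ - χ) + 2 * normSq (ψ - χ) := by
  have := weight_add_le (φ - χ) (χ - ψ) (fun _ => True) one_pos
  rw [sub_add_sub_cancel] at this
  rw [normSq_sub_comm ψ χ]
  simp only [normSq]
  linarith

theorem le_normSq_sub {φ ψ : Superposition F} {P : Config F → Prop} (hφ : 2 / 3 ≤ weight φ P)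
    (hψ : weight ψ P ≤ 1 / 3) : 1 / 18 ≤ normSq (φ - ψ) := by
  have := weight_add_le ψ (φ - ψ) P (half_pos one_pos)
  rw [add_sub_cancel] at this
  linarith [weight_le_normSq (φ - ψ) P]

theorem normSq_sum_le {ι : Type*} (t : Finset ι) (φ : ι → Superposition F) :
    normSq (∑ i ∈ t, φ i) ≤ t.card * ∑ i ∈ t, normSq (φ i) := by
  classical
  set s := t.biUnion fun i => (φ i).support with hs
  have hφ (i) (hi : i ∈ t) : normSq (φ i) = ∑ c ∈ s, ‖φ i c‖ ^ 2 :=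
    normSq_eq_sum _ (Finset.subset_biUnion_of_mem (fun i => (φ i).support) hi)
  rw [normSq_eq_sum _ Finsupp.support_finsetSum, ← hs, Finset.sum_congr rfl hφ, Finset.sum_comm,
    Finset.mul_sum]
  gcongr with c
  rw [Finsupp.finsetSum_apply]
  calc ‖∑ i ∈ t, φ i c‖ ^ 2 ≤ (∑ i ∈ t, ‖φ i c‖) ^ 2 := by
        gcongr
        exact norm_sum_le _ _
    _ ≤ _ := sq_sum_le_card_mul_sum_sq

end Weights

section Queries

/-- The configuration is about to query a word of `W`. -/
def Config.Queries (c : Config F) (W : Set (List Bool)) : Prop :=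
  c.state = F.query ∧ ∃ a, ∃ w ∈ W, ∃ b, c.tape 1 = wordTape a (w ++ [b])

theorem Config.Queries.mono {c : Config F} {V W : Set (List Bool)} (hVW : V ⊆ W)
    (h : c.Queries V) : c.Queries W := by
  obtain ⟨hq, a, w, hw, b, ht⟩ := h
  exact ⟨hq, a, w, hVW hw, b, ht⟩

theorem Config.Queries.exists_mem_inter {c : Config F} {V W : Set (List Bool)}
    (hV : c.Queries V) (hW : c.Queries W) : (V ∩ W).Nonempty := by
  obtain ⟨-, a, w, hw, b, ht⟩ := hV
  obtain ⟨-, a', w', hw', b', ht'⟩ := hW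
  obtain ⟨-, rfl, -⟩ := wordTape_concat_injective (ht.symm.trans ht')
  exact ⟨w, hw, hw'⟩

theorem Config.call_congr {A H : Oracle} {c : Config F} (hq : c.state = F.query)
    (h : ¬ c.Queries {w | A w ≠ H w}) : c.call A = c.call H := by
  suffices callTape A (c.tape 1) = callTape H (c.tape 1) by simp only [Config.call, this]
  by_cases ht : ∃ a w b, c.tape 1 = wordTape a (w ++ [b])
  · obtain ⟨a, w, b, ht⟩ := ht
    have hw : A w = H w := by
      by_contra hne
      exact h ⟨hq, a, w, hne, b, ht⟩
    rw [ht, callTape_wordTape, callTape_wordTape, hw]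
  · push Not at ht
    rw [callTape_of_forall_ne _ ht, callTape_of_forall_ne _ ht]

end Queries

namespace QuantumMachine

variable {M : QuantumMachine}

theorem stepConfig_congr {A H : Oracle} {c : Config M.toFrame}
    (h : ¬ c.Queries {w | A w ≠ H w}) : M.stepConfig A c = M.stepConfig H c := by
  unfold stepConfig
  split_ifs with hq
  · rw [Config.call_congr hq h]
  · rfl

theorem WellFormed.normSq_evolve (hM : M.WellFormed) (A : Oracle) (φ : Superposition M.toFrame) :
    normSq (M.evolve A φ) = normSq φ :=
  hM A φ

theorem WellFormed.normSq_iterate (hM : M.WellFormed) (A : Oracle) (φ : Superposition M.toFrame)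
    (k : ℕ) : normSq ((M.evolve A)^[k] φ) = normSq φ := by
  induction k with
  | zero => rfl
  | succ k ih => rw [Function.iterate_succ_apply', hM.normSq_evolve, ih]

theorem WellFormed.normSq_run (hM : M.WellFormed) (A : Oracle) (x : List Bool) (t : ℕ) :
    normSq (M.run A x t) = 1 := by
  rw [run, hM.normSq_iterate, normSq_single]
  simp

theorem WellFormed.normSq_evolve_sub_evolve_le (hM : M.WellFormed) (A H : Oracle)
    (φ : Superposition M.toFrame) :
    normSq (M.evolve A φ - M.evolve H φ) ≤ 4 * weight φ fun c => c.Queries {w | A w ≠ H w} := by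
  classical
  set D : Config M.toFrame → Prop := fun c => c.Queries {w | A w ≠ H w}
  have agree : M.evolve A (φ.filter fun c => ¬ D c) = M.evolve H (φ.filter fun c => ¬ D c) := by
    simp only [evolve, Finsupp.linearCombination_apply]
    refine Finsupp.sum_congr fun c hc => ?_
    rw [Finsupp.support_filter, Finset.mem_filter] at hc
    rw [stepConfig_congr hc.2]
  have evolve_split (B : Oracle) :
      M.evolve B φ = M.evolve B (φ.filter D) + M.evolve B (φ.filter fun c => ¬ D c) := by
    rw [← map_add, Finsupp.filter_add_filter_not]
  calc normSq (M.evolve A φ - M.evolve H φ)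
      = normSq (M.evolve A (φ.filter D) - M.evolve H (φ.filter D)) := by
        rw [evolve_split A, evolve_split H, agree, add_sub_add_right_eq_sub]
    _ ≤ 2 * normSq (M.evolve A (φ.filter D)) + 2 * normSq (M.evolve H (φ.filter D)) := by
        simpa only [sub_zero] using normSq_sub_le (M.evolve A (φ.filter D)) _ 0
    _ = 4 * weight φ D := by
        rw [hM.normSq_evolve, hM.normSq_evolve, normSq_filter]
        ring

theorem run_succ (A : Oracle) (x : List Bool) (t : ℕ) :
    M.run A x (t + 1) = M.evolve A (M.run A x t) :=
  Function.iterate_succ_apply' ..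

/-- The evolutions under two oracles are compared through hybrids: `s` steps with `A`, the remaining
ones with `H`. -/
theorem run_sub_run (A H : Oracle) (x : List Bool) (t : ℕ) :
    M.run A x t - M.run H x t = ∑ s ∈ Finset.range t, (M.evolve H)^[t - 1 - s]
      (M.evolve A (M.run A x s) - M.evolve H (M.run A x s)) := by
  simp only [← Module.End.coe_pow]
  have hybrid (s) (hs : s ∈ Finset.range t) : (M.evolve H ^ (t - 1 - s))
      (M.evolve A (M.run A x s) - M.evolve H (M.run A x s)) =
      (M.evolve H ^ (t - (s + 1))) (M.run A x (s + 1)) - (M.evolve H ^ (t - s)) (M.run A x s) := by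
    obtain ⟨k, rfl⟩ := Nat.exists_eq_add_of_lt (Finset.mem_range.1 hs)
    rw [map_sub, ← run_succ, ← Module.End.mul_apply, ← pow_succ]
    congr 3 <;> omega
  rw [Finset.sum_congr rfl hybrid,
    Finset.sum_range_sub fun s => (M.evolve H ^ (t - s)) (M.run A x s)]
  simp [run, Module.End.coe_pow]

/-- The total weight, over the first `t` steps, of the queries of words of `W`. -/
noncomputable def queryWeight (M : QuantumMachine) (A : Oracle) (x : List Bool) (t : ℕ)
    (W : Set (List Bool)) : ℝ :=
  ∑ s ∈ Finset.range t, weight (M.run A x s) fun c => c.Queries W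

theorem queryWeight_nonneg (A : Oracle) (x : List Bool) (t : ℕ) (W : Set (List Bool)) :
    0 ≤ M.queryWeight A x t W :=
  Finset.sum_nonneg fun _ _ => weight_nonneg _ _

theorem queryWeight_mono (A : Oracle) (x : List Bool) {s t : ℕ} (hst : s ≤ t)
    {V W : Set (List Bool)} (hVW : V ⊆ W) : M.queryWeight A x s V ≤ M.queryWeight A x t W :=
  calc M.queryWeight A x s V ≤ M.queryWeight A x s W :=
        Finset.sum_le_sum fun _ _ => weight_mono _ fun _ => Config.Queries.mono hVW
    _ ≤ M.queryWeight A x t W :=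
        Finset.sum_le_sum_of_subset_of_nonneg (Finset.range_mono hst) fun _ _ _ => weight_nonneg _ _

theorem queryWeight_union_le (A : Oracle) (x : List Bool) (t : ℕ) (V W : Set (List Bool)) :
    M.queryWeight A x t (V ∪ W) ≤ M.queryWeight A x t V + M.queryWeight A x t W := by
  unfold queryWeight
  rw [← Finset.sum_add_distrib]
  refine Finset.sum_le_sum fun _ _ => (weight_mono _ ?_).trans (weight_or_le _ _ _)
  rintro c ⟨hq, a, w, hw | hw, b, ht⟩
  · exact Or.inl ⟨hq, a, w, hw, b, ht⟩
  · exact Or.inr ⟨hq, a, w, hw, b, ht⟩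

theorem WellFormed.sum_queryWeight_le (hM : M.WellFormed) {ι : Type*} (I : Finset ι) (A : Oracle)
    (x : List Bool) (t : ℕ) {W : ι → Set (List Bool)} (hW : (I : Set ι).PairwiseDisjoint W) :
    ∑ i ∈ I, M.queryWeight A x t (W i) ≤ t := by
  have at_time (s : ℕ) : ∑ i ∈ I, weight (M.run A x s) (fun c => c.Queries (W i)) ≤ 1 := by
    rw [← hM.normSq_run A x s]
    refine sum_weight_le_normSq I _ fun c i hi j hj hci hcj => ?_
    obtain ⟨w, hwi, hwj⟩ := hci.exists_mem_inter hcj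
    exact hW.elim_set hi hj w hwi hwj
  unfold queryWeight
  rw [Finset.sum_comm]
  simpa using Finset.sum_le_card_nsmul (Finset.range t) _ 1 fun s _ => at_time s

theorem WellFormed.normSq_run_sub_run_le (hM : M.WellFormed) (A H : Oracle) (x : List Bool)
    (t : ℕ) : normSq (M.run A x t - M.run H x t) ≤
      4 * t * M.queryWeight A x t {w | A w ≠ H w} := by
  calc normSq (M.run A x t - M.run H x t)
      ≤ t * ∑ s ∈ Finset.range t, normSq ((M.evolve H)^[t - 1 - s]
          (M.evolve A (M.run A x s) - M.evolve H (M.run A x s))) := by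
        rw [run_sub_run]
        simpa only [Finset.card_range] using normSq_sum_le (Finset.range t) _
    _ ≤ t * ∑ s ∈ Finset.range t,
          4 * weight (M.run A x s) fun c => c.Queries {w | A w ≠ H w} := by
        gcongr with s _
        rw [hM.normSq_iterate]
        exact hM.normSq_evolve_sub_evolve_le A H _
    _ = 4 * t * M.queryWeight A x t {w | A w ≠ H w} := by
        rw [← Finset.mul_sum, queryWeight]
        ring

/-- With oracle `A`, on input `y`, the machine halts within `τ` steps and its output is then `x`
with probability at least `2 / 3`. -/
def Finds (M : QuantumMachine) (A : Oracle) (y x : List Bool) (τ : ℕ) : Prop :=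
  ∃ t ≤ τ, M.HaltsAt A y t ∧ 2 / 3 ≤ weight (M.run A y t) (fun c => c.Outputs x)

theorem WellFormed.weight_outputs_le (hM : M.WellFormed) {A : Oracle} {y x x' : List Bool} {t : ℕ}
    (hx : x ≠ x') (h : 2 / 3 ≤ weight (M.run A y t) fun c => c.Outputs x) :
    weight (M.run A y t) (fun c => c.Outputs x') ≤ 1 / 3 := by
  have exclusive : weight (M.run A y t) (fun c => c.Outputs x') ≤
      weight (M.run A y t) fun c => ¬ c.Outputs x :=
    weight_mono _ fun c hx' h => hx (h.unique hx')
  have := weight_add_weight_not (M.run A y t) fun c => c.Outputs x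
  rw [hM.normSq_run] at this
  linarith

theorem WellFormed.exists_le_normSq_sub (hM : M.WellFormed) {A A' : Oracle} {y x x' : List Bool}
    {τ : ℕ} (h : M.Finds A y x τ) (h' : M.Finds A' y x' τ) (hx : x ≠ x') :
    ∃ s ≤ τ, 1 / 18 ≤ normSq (M.run A y s - M.run A' y s) := by
  obtain ⟨t, ht, hhalt, hout⟩ := h
  obtain ⟨t', ht', hhalt', hout'⟩ := h'
  wlog htt' : t ≤ t' generalizing A A' x x' t t'
  · simpa only [normSq_sub_comm (M.run A y _)] using
      this hx.symm t' ht' hhalt' hout' t ht hhalt hout (le_of_not_ge htt')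
  refine ⟨t, ht, ?_⟩
  obtain htt' | rfl := htt'.lt_or_eq
  · apply le_normSq_sub (P := fun c => c.state = M.final)
    · rw [weight_eq_normSq hhalt.1, hM.normSq_run]
      norm_num
    · rw [weight_eq_zero (hhalt'.2 t htt')]
      norm_num
  · exact le_normSq_sub hout (hM.weight_outputs_le hx.symm hout')

theorem WellFormed.le_queryWeight (hM : M.WellFormed) {A A' : Oracle} (H : Oracle)
    {y x x' : List Bool} {τ : ℕ} (h : M.Finds A y x τ) (h' : M.Finds A' y x' τ) (hx : x ≠ x') :
    1 / 144 ≤ τ * (M.queryWeight A y τ {w | A w ≠ H w} +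
      M.queryWeight A' y τ {w | A' w ≠ H w}) := by
  obtain ⟨s, hs, hdist⟩ := hM.exists_le_normSq_sub h h' hx
  have close (B : Oracle) : normSq (M.run B y s - M.run H y s) ≤
      4 * (τ * M.queryWeight B y τ {w | B w ≠ H w}) :=
    calc normSq (M.run B y s - M.run H y s) ≤ 4 * s * M.queryWeight B y s {w | B w ≠ H w} :=
          hM.normSq_run_sub_run_le B H y s
      _ ≤ 4 * τ * M.queryWeight B y τ {w | B w ≠ H w} := by
          gcongr
          · exact queryWeight_nonneg _ _ _ _
          · exact queryWeight_mono _ _ hs subset_rfl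
      _ = _ := by ring
  linarith [normSq_sub_le (M.run A y s) (M.run A' y s) (M.run H y s), close A, close A']

end QuantumMachine

/-! ### Inverting a random permutation -/

section PermutationOracles

/-- The word `x` of the code `1 ^ i 0 x` of a pair `(x, i)`. -/
def decode (w : List Bool) : List Bool := (w.dropWhile id).tail

namespace Permutations

/-- The permutation of `{0,1}*` given by a family of permutations. -/
def toEquiv (π : Permutations) : List Bool ≃ List Bool :=
  List.equivSigmaTuple.trans ((Equiv.sigmaCongrRight π).trans List.equivSigmaTuple.symm)

theorem coe_toEquiv (π : Permutations) : ⇑π.toEquiv = π.toFun := rfl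

theorem bijective_toFun (π : Permutations) : Function.Bijective π.toFun :=
  π.coe_toEquiv ▸ π.toEquiv.bijective

theorem length_toFun (π : Permutations) (x : List Bool) : (π.toFun x).length = x.length :=
  List.length_ofFn

theorem toFun_ofFn (π : Permutations) {n : ℕ} (x : Fin n → Bool) :
    π.toFun (List.ofFn x) = List.ofFn (π n x) :=
  congrArg (fun s => List.equivSigmaTuple.symm (Equiv.sigmaCongrRight π s))
    (List.equivSigmaTuple.apply_symm_apply ⟨n, x⟩)

theorem toFun_congr {π π' : Permutations} {v : List Bool} (h : π v.length = π' v.length) :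
    π.toFun v = π'.toFun v := by
  simp only [toFun, h]

theorem oracle_congr {π π' : Permutations} {w : List Bool}
    (h : π.toFun (decode w) = π'.toFun (decode w)) : π.oracle w = π'.oracle w := by
  rw [decode] at h
  simp only [oracle, h]

theorem oracle_update_congr (π : Permutations) {n : ℕ} {σ σ' : Equiv.Perm (Fin n → Bool)}
    {w : List Bool} (h : ∀ x, decode w = List.ofFn x → σ x = σ' x) :
    oracle (Function.update π n σ) w = oracle (Function.update π n σ') w := by
  apply oracle_congr
  by_cases hn : ∃ x : Fin n → Bool, decode w = List.ofFn x
  · obtain ⟨x, hx⟩ := hn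
    rw [hx, toFun_ofFn, toFun_ofFn, Function.update_self, Function.update_self, h x hx]
  · have length_ne : (decode w).length ≠ n := by
      rintro rfl
      exact hn ⟨_, (List.ofFn_get _).symm⟩
    apply toFun_congr
    rw [Function.update_of_ne length_ne, Function.update_of_ne length_ne]

end Permutations

end PermutationOracles

namespace QuantumMachine

variable {M : QuantumMachine} {n : ℕ}

open Classical in
/-- The words of length `n` that have a large query weight when the machine runs with oracle `A` for
`τ` steps on input `y`. The threshold splits the bound `1 / 144` of `WellFormed.le_queryWeight`
among three words. -/
noncomputable def heavyWords (M : QuantumMachine) (A : Oracle) (y : List Bool) (τ n : ℕ) :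
    Finset (Fin n → Bool) :=
  {x | 1 / 432 ≤ τ * M.queryWeight A y τ {w | decode w = List.ofFn x}}

theorem mem_heavyWords {A : Oracle} {y : List Bool} {τ : ℕ} {x : Fin n → Bool} :
    x ∈ M.heavyWords A y τ n ↔
      1 / 432 ≤ τ * M.queryWeight A y τ {w | decode w = List.ofFn x} := by
  simp [heavyWords]

theorem WellFormed.card_heavyWords_le (hM : M.WellFormed) (A : Oracle) (y : List Bool) (τ n : ℕ) :
    (M.heavyWords A y τ n).card ≤ 432 * τ ^ 2 := by
  have disjoint : ((M.heavyWords A y τ n : Finset _) : Set (Fin n → Bool)).PairwiseDisjoint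
      fun x => {w | decode w = List.ofFn x} := fun x _ x' _ hx =>
    Set.disjoint_left.2 fun _ hw hw' => hx (List.ofFn_injective (hw.symm.trans hw'))
  have : (M.heavyWords A y τ n).card • (1 / 432 : ℝ) ≤ τ * τ :=
    calc (M.heavyWords A y τ n).card • (1 / 432 : ℝ)
        ≤ ∑ x ∈ M.heavyWords A y τ n, τ * M.queryWeight A y τ {w | decode w = List.ofFn x} :=
          Finset.card_nsmul_le_sum _ _ _ fun x hx => mem_heavyWords.1 hx
      _ ≤ τ * τ := by
          rw [← Finset.mul_sum]
          gcongr
          exact hM.sum_queryWeight_le _ A y τ disjoint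
  rw [nsmul_eq_mul] at this
  exact_mod_cast show ((M.heavyWords A y τ n).card : ℝ) ≤ 432 * τ ^ 2 by linarith

open Classical in
theorem WellFormed.exists_mem_heavyWords (hM : M.WellFormed) (π : Permutations)
    {ρ ρ' : Equiv.Perm (Fin n → Bool)} {y : List Bool} {u v c : Fin n → Bool} {τ : ℕ}
    (hu : M.Finds (Permutations.oracle (Function.update π n ρ)) y (List.ofFn u) τ)
    (hv : M.Finds (Permutations.oracle (Function.update π n ρ')) y (List.ofFn v) τ)
    (huv : u ≠ v) (hρ : ∀ x, x ≠ u → x ≠ v → x ≠ c → ρ x = ρ' x) :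
    v ∈ M.heavyWords (Permutations.oracle (Function.update π n ρ)) y τ n ∨
      u ∈ M.heavyWords (Permutations.oracle (Function.update π n ρ')) y τ n ∨
      c ∈ M.heavyWords (Permutations.oracle (Function.update π n ρ)) y τ n := by
  set A := Permutations.oracle (Function.update π n ρ)
  set A' := Permutations.oracle (Function.update π n ρ')
  -- If `ρ u = y = ρ' v`, this is the oracle of a function that takes the value `y` at both places.
  set H : Oracle := fun w => if decode w = List.ofFn u then A w else A' w with hH
  have query_le : M.queryWeight A y τ {w | A w ≠ H w} ≤
      M.queryWeight A y τ {w | decode w = List.ofFn v} +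
        M.queryWeight A y τ {w | decode w = List.ofFn c} := by
    refine (queryWeight_mono _ _ le_rfl fun w hw => ?_).trans (queryWeight_union_le _ _ _ _ _)
    by_contra hvc
    simp only [Set.mem_union, Set.mem_ofPred_eq, not_or] at hvc
    refine hw ?_
    simp only [hH]
    split_ifs with hdec
    · rfl
    refine Permutations.oracle_update_congr π fun x hx => ?_
    rw [hx] at hdec hvc
    exact hρ x (mt (congrArg _) hdec) (mt (congrArg _) hvc.1) (mt (congrArg _) hvc.2)
  have query_le' : M.queryWeight A' y τ {w | A' w ≠ H w} ≤
      M.queryWeight A' y τ {w | decode w = List.ofFn u} :=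
    queryWeight_mono _ _ le_rfl fun w hw => by
      by_contra hdec
      exact hw (if_neg hdec).symm
  have total := hM.le_queryWeight H hu hv (List.ofFn_injective.ne huv)
  have := mul_le_mul_of_nonneg_left (add_le_add query_le query_le') τ.cast_nonneg (α := ℝ)
  simp only [mem_heavyWords]
  by_contra! light
  linarith [light.1, light.2.1, light.2.2]

/-- With the oracle of `π`, the machine inverts `π` at the word `y` within `τ` steps. -/
def FindsPreimage (M : QuantumMachine) (π : Permutations) (y : Fin n → Bool) (τ : ℕ) : Prop :=
  M.Finds π.oracle (List.ofFn y) (List.ofFn ((π n).symm y)) τ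

open Classical in
theorem WellFormed.card_findsPreimage_le (hM : M.WellFormed) (π : Permutations)
    (y : Fin n → Bool) (τ : ℕ) :
    (Finset.univ.filter fun σ : Equiv.Perm (Fin n → Bool) =>
      M.FindsPreimage (Function.update π n σ) y τ).card ^ 2 * 2 ^ n ≤
      Fintype.card (Equiv.Perm (Fin n → Bool)) ^ 2 * (3 * (432 * τ ^ 2) + 1) := by
  rw [show 2 ^ n = Fintype.card (Fin n → Bool) by simp]
  refine sq_card_perm_mul_card_le y _ (fun σ => hM.card_heavyWords_le
    (Permutations.oracle (Function.update π n σ)) (List.ofFn y) τ n) ?_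
  intro ρ hρ ρ' hρ' c huv agree
  simp only [Finset.mem_filter_univ, FindsPreimage, Function.update_self] at hρ hρ'
  exact hM.exists_mem_heavyWords π hρ hρ' huv agree

end QuantumMachine

namespace QuantumMachine

variable {M : QuantumMachine}

/-- In finite time a machine consults only finitely many values of the oracle. -/
theorem eventually_run_eq {ι : Type*} {l : Filter ι} {A : ι → Oracle} {A₀ : Oracle}
    (h : ∀ w, ∀ᶠ i in l, A i w = A₀ w) (x : List Bool) (t : ℕ) :
    ∀ᶠ i in l, M.run (A i) x t = M.run A₀ x t := by
  induction t with
  | zero => simp only [run, Function.iterate_zero, id_eq, Filter.eventually_true]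
  | succ t ih =>
    have step (c : Config M.toFrame) : ∀ᶠ i in l, M.stepConfig (A i) c = M.stepConfig A₀ c := by
      by_cases hc : c.Queries Set.univ
      · obtain ⟨-, a, w, -, b, ht⟩ := hc
        filter_upwards [h w] with i hi
        refine stepConfig_congr ?_
        rintro ⟨-, a', w', hw', b', ht'⟩
        obtain ⟨-, rfl, -⟩ := wordTape_concat_injective (ht.symm.trans ht')
        exact hw' hi
      · exact Filter.Eventually.of_forall fun i =>
          stepConfig_congr fun hq => hc (hq.mono (Set.subset_univ _))
    filter_upwards [ih, (Filter.eventually_all_finset (M.run A₀ x t).support).2 fun c _ => step c]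
      with i run_eq step_eq
    rw [run_succ, run_succ, run_eq]
    simp only [evolve, Finsupp.linearCombination_apply]
    exact Finsupp.sum_congr fun c hc => by rw [step_eq c hc]

theorem eventually_finds {ι : Type*} {l : Filter ι} {A : ι → Oracle} {A₀ : Oracle}
    (h : ∀ w, ∀ᶠ i in l, A i w = A₀ w) {y x : List Bool} {τ : ℕ} (hf : M.Finds A₀ y x τ) :
    ∀ᶠ i in l, M.Finds (A i) y x τ := by
  obtain ⟨t, ht, ⟨final, not_final⟩, output⟩ := hf
  filter_upwards [eventually_run_eq h y t, (Filter.eventually_all_finset (Finset.range t)).2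
    fun s _ => eventually_run_eq h y s] with i run_t run_s
  refine ⟨t, ht, ⟨?_, fun s hs => ?_⟩, ?_⟩
  · rwa [run_t]
  · rw [run_s s (Finset.mem_range.2 hs)]
    exact not_final s hs
  · rwa [run_t]

theorem measurableSet_findsPreimage (M : QuantumMachine) {n : ℕ} (y : Fin n → Bool) (τ : ℕ) :
    MeasurableSet {π : Permutations | M.FindsPreimage π y τ} := by
  -- The event is open when every `Equiv.Perm (Fin k → Bool)` has the discrete topology.
  let _ (k : ℕ) : TopologicalSpace (Equiv.Perm (Fin k → Bool)) := ⊥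
  have _ (k : ℕ) : DiscreteTopology (Equiv.Perm (Fin k → Bool)) := ⟨rfl⟩
  have _ (k : ℕ) : BorelSpace (Equiv.Perm (Fin k → Bool)) := ⟨borel_eq_top_of_discrete.symm⟩
  have eventually_apply_eq (π : Permutations) (k : ℕ) : ∀ᶠ π' in nhds π, π' k = π k :=
    (continuous_apply (A := fun k => Equiv.Perm (Fin k → Bool)) k).continuousAt.eventually_mem
      (mem_nhds_discrete.2 (Set.mem_singleton (π k)))
  refine (isOpen_iff_eventually.2 fun π hπ => ?_).measurableSet
  have eventually_oracle_eq (w : List Bool) : ∀ᶠ π' in nhds π, π'.oracle w = π.oracle w := by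
    filter_upwards [eventually_apply_eq π (decode w).length] with π' h
    exact Permutations.oracle_congr (Permutations.toFun_congr h)
  filter_upwards [eventually_finds eventually_oracle_eq hπ, eventually_apply_eq π n]
    with π' finds apply_eq
  rwa [← apply_eq] at finds

end QuantumMachine

section Resampling

open Measure

variable {ι : Type*} [DecidableEq ι] {X : ι → Type*} [∀ i, MeasurableSpace (X i)]
  (μ : (i : ι) → Measure (X i)) [∀ i, IsProbabilityMeasure (μ i)]

theorem infinitePi_map_update (i : ι) :
    ((infinitePi μ).prod (μ i)).map (fun p => Function.update p.1 i p.2) = infinitePi μ := by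
  refine eq_infinitePi μ fun s t ht => ?_
  have preimage_pi : (fun p : ((i : ι) → X i) × X i => Function.update p.1 i p.2) ⁻¹'
      Set.pi s t = Set.pi (s.erase i) t ×ˢ (if i ∈ s then t i else Set.univ) := by
    ext ⟨ω, x⟩
    simp only [Set.mem_preimage, Set.mem_pi, Set.mem_prod, Finset.mem_coe, Finset.mem_erase]
    constructor
    · intro h
      refine ⟨fun j hj => by simpa [hj.1] using h j hj.2, ?_⟩
      split_ifs with hi
      · simpa using h i hi
      · trivial
    · rintro ⟨hω, hx⟩ j hj
      obtain rfl | hji := eq_or_ne j i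
      · simpa [hj] using hx
      · simpa [hji] using hω j ⟨hji, hj⟩
  rw [map_apply measurable_update' (MeasurableSet.pi s.countable_toSet fun j _ => ht j),
    preimage_pi, prod_prod, infinitePi_pi _ fun j _ => ht j]
  split_ifs with hi
  · exact Finset.prod_erase_mul s _ hi
  · rw [measure_univ, mul_one, Finset.erase_eq_of_notMem hi]

theorem infinitePi_le_of_forall_update_le (i : ι) {E : Set ((i : ι) → X i)} (hE : MeasurableSet E)
    {δ : ENNReal} (h : ∀ ω, μ i {x | Function.update ω i x ∈ E} ≤ δ) : infinitePi μ E ≤ δ := by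
  rw [← infinitePi_map_update μ i, map_apply measurable_update' hE,
    prod_apply (measurable_update' hE)]
  calc ∫⁻ ω, μ i {x | Function.update ω i x ∈ E} ∂infinitePi μ
      ≤ ∫⁻ _, δ ∂infinitePi μ := lintegral_mono h
    _ = δ := by rw [lintegral_const, measure_univ, mul_one]

end Resampling

theorem toMeasure_uniformOfFintype_le_sqrt {α : Type*} [Fintype α] [Nonempty α]
    [MeasurableSpace α] {P : α → Prop} [DecidablePred P] (hP : MeasurableSet {a | P a}) {p q : ℝ}
    (hq : 0 < q) (h : (Finset.univ.filter P).card ^ 2 * q ≤ Fintype.card α ^ 2 * p) :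
    (PMF.uniformOfFintype α).toMeasure {a | P a} ≤ ENNReal.ofReal √(p / q) := by
  have card_pos : (0 : ℝ) < Fintype.card α := Nat.cast_pos.2 Fintype.card_pos
  rw [PMF.toMeasure_uniformOfFintype_apply _ hP,
    Fintype.card_of_subtype (Finset.univ.filter P) (by simp), ← ENNReal.ofReal_natCast,
    ← ENNReal.ofReal_natCast (Fintype.card α), ← ENNReal.ofReal_div_of_pos card_pos]
  refine ENNReal.ofReal_le_ofReal (Real.le_sqrt_of_sq_le ?_)
  rw [div_pow, div_le_div_iff₀ (by positivity) hq, mul_comm p]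
  exact h

theorem sqrt_floor_two_rpow_le (n : ℕ) :
    √((1296 * ⌊(2 : ℝ) ^ ((n : ℝ) / 3)⌋₊ ^ 2 + 1) / 2 ^ n) ≤
      37 * ((2 : ℝ) ^ (-(1 / 6) : ℝ)) ^ n := by
  set q := (2 : ℝ) ^ ((n : ℝ) / 3) with hq
  set r := ((2 : ℝ) ^ (-(1 / 6) : ℝ)) ^ n with hr
  have q_pos : 0 < q := by positivity
  have one_le_q : 1 ≤ q := Real.one_le_rpow one_le_two (by positivity)
  have floor_le : (⌊q⌋₊ : ℝ) ≤ q := Nat.floor_le q_pos.le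
  have q_pow_three : q ^ 3 = 2 ^ n := by
    rw [hq, ← Real.rpow_mul_natCast zero_le_two, ← Real.rpow_natCast]
    congr 1
    push_cast
    ring
  have r_sq : r ^ 2 = q⁻¹ := by
    rw [hr, hq, ← pow_mul, ← Real.rpow_mul_natCast zero_le_two, ← Real.rpow_neg zero_le_two]
    congr 1
    push_cast
    ring
  refine Real.sqrt_le_iff.2 ⟨by positivity, ?_⟩
  calc (1296 * (⌊q⌋₊ : ℝ) ^ 2 + 1) / 2 ^ n ≤ (1296 * q ^ 2 + q ^ 2) / q ^ 3 := by
        rw [q_pow_three]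
        gcongr
        exact one_le_pow₀ one_le_q
    _ ≤ (37 ^ 2 * q ^ 2) / q ^ 3 := by
        gcongr
        linarith [sq_nonneg q]
    _ = (37 * r) ^ 2 := by
        rw [mul_pow, r_sq]
        field_simp

namespace QuantumMachine

variable {M : QuantumMachine}

theorem WellFormed.measure_findsPreimage_le (hM : M.WellFormed) {n : ℕ} (y : Fin n → Bool)
    (τ : ℕ) : randomPermutations {π | M.FindsPreimage π y τ} ≤
      ENNReal.ofReal √((1296 * τ ^ 2 + 1) / 2 ^ n) := by
  classical
  refine infinitePi_le_of_forall_update_le _ n (M.measurableSet_findsPreimage y τ) fun π => ?_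
  refine toMeasure_uniformOfFintype_le_sqrt
    (P := fun σ => M.FindsPreimage (Function.update π n σ) y τ)
    MeasurableSpace.measurableSet_top (by positivity) ?_
  have card_le := hM.card_findsPreimage_le π y τ
  rify at card_le
  linarith only [card_le]

theorem WellFormed.ae_eventually_not_findsPreimage (hM : M.WellFormed)
    (y : (n : ℕ) → Fin n → Bool) :
    ∀ᵐ π ∂randomPermutations, ∀ᶠ n : ℕ in Filter.atTop,
      ¬ M.FindsPreimage π (y n) ⌊(2 : ℝ) ^ ((n : ℝ) / 3)⌋₊ := by
  have ratio_lt_one : (2 : ℝ) ^ (-(1 / 6) : ℝ) < 1 :=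
    Real.rpow_lt_one_of_one_lt_of_neg one_lt_two (by norm_num)
  have summable : Summable fun n : ℕ => 37 * ((2 : ℝ) ^ (-(1 / 6) : ℝ)) ^ n :=
    (summable_geometric_of_lt_one (by positivity) ratio_lt_one).mul_left _
  refine ae_eventually_notMem (ne_top_of_le_ne_top summable.tsum_ofReal_ne_top
    (ENNReal.tsum_le_tsum fun n => ?_))
  exact (hM.measure_findsPreimage_le (y n) _).trans
    (ENNReal.ofReal_le_ofReal (sqrt_floor_two_rpow_le n))

theorem InvertsInTime.findsPreimage {π : Permutations} {T : ℕ → ℕ}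
    (h : M.InvertsInTime π.oracle π.toFun T) {n : ℕ} (y : Fin n → Bool) :
    M.FindsPreimage π y (T n) := by
  have := h (List.ofFn ((π n).symm y))
  rwa [Permutations.toFun_ofFn, Equiv.apply_symm_apply, List.length_ofFn] at this

theorem FindsPreimage.mono {π : Permutations} {n : ℕ} {y : Fin n → Bool} {τ τ' : ℕ}
    (h : M.FindsPreimage π y τ) (hτ : τ ≤ τ') : M.FindsPreimage π y τ' :=
  let ⟨t, ht, halts_output⟩ := h
  ⟨t, ht.trans hτ, halts_output⟩

theorem WellFormed.ae_isBigO (hM : M.WellFormed) :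
    ∀ᵐ π ∂randomPermutations, ∀ T : ℕ → ℕ, M.InvertsInTime π.oracle π.toFun T →
      (fun n : ℕ => (2 : ℝ) ^ ((n : ℝ) / 3)) =O[Filter.atTop] (fun n : ℕ => (T n : ℝ)) := by
  filter_upwards [hM.ae_eventually_not_findsPreimage fun _ _ => false] with π hπ T hT
  refine Asymptotics.IsBigO.of_bound' ?_
  filter_upwards [hπ] with n hn
  rw [Real.norm_of_nonneg (by positivity), Real.norm_of_nonneg (by positivity)]
  by_contra! hlt
  exact hn ((hT.findsPreimage _).mono (Nat.le_floor hlt.le))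

end QuantumMachine

section Countability

instance : Countable Frame := by
  refine Function.Injective.countable (β := Σ s w : ℕ, Fin s × Fin s × Fin s × Fin s × Fin (w + 2))
    (f := fun F => ⟨F.states, F.work, F.start, F.final, F.query, F.answer, F.out⟩) ?_
  rintro ⟨⟩ ⟨⟩ h
  simp only [Sigma.mk.injEq] at h
  obtain ⟨rfl, h⟩ := h
  simp only [heq_eq_eq, Sigma.mk.injEq] at h
  obtain ⟨rfl, h⟩ := h
  simp only [heq_eq_eq, Prod.mk.injEq] at h
  obtain ⟨rfl, rfl, rfl, rfl, rfl⟩ := h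
  rfl

instance : Countable DetMachine := by
  refine Function.Injective.countable
    (β := Σ F : Frame, (Fin F.states → F.Scan → F.Action)) (f := fun M => ⟨M.toFrame, M.delta⟩) ?_
  rintro ⟨F, delta⟩ ⟨F', delta'⟩ h
  obtain ⟨rfl, h⟩ := Sigma.mk.inj h
  obtain rfl : delta = delta' := eq_of_heq h
  rfl

theorem DetMachine.HaltsAt.unique {M : DetMachine} {A : Oracle} {x : List Bool} {s t : ℕ}
    (hs : M.HaltsAt A x s) (ht : M.HaltsAt A x t) : s = t :=
  le_antisymm (not_lt.1 fun h => hs.2 t h ht.1) (not_lt.1 fun h => ht.2 s h hs.1)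

theorem DetMachine.ComputesInTime.unique {M : DetMachine} {A : Oracle}
    {f g : List Bool → List Bool} {S T : ℕ → ℕ} (hf : M.ComputesInTime A f S)
    (hg : M.ComputesInTime A g T) : f = g := by
  funext x
  obtain ⟨s, -, hs, outputs_f⟩ := hf x
  obtain ⟨t, -, ht, outputs_g⟩ := hg x
  obtain rfl := hs.unique ht
  exact outputs_f.unique outputs_g

theorem eq_of_abs_sub_le_two_pow {r s : ℝ} {d : ℕ → ℝ} (hr : ∀ n, |r - d n| ≤ 1 / 2 ^ n)
    (hs : ∀ n, |s - d n| ≤ 1 / 2 ^ n) : r = s := by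
  have tendsto_of_le {u : ℝ} (hu : ∀ n, |u - d n| ≤ 1 / 2 ^ n) :
      Filter.Tendsto d Filter.atTop (nhds u) := by
    rw [tendsto_iff_dist_tendsto_zero]
    refine squeeze_zero (fun _ => dist_nonneg) (fun n => ?_)
      (tendsto_pow_atTop_nhds_zero_of_lt_one (r := (1 / 2 : ℝ)) (by norm_num) (by norm_num))
    rw [dist_comm, Real.dist_eq, one_div_pow]
    exact hu n
  exact tendsto_nhds_unique (tendsto_of_le hr) (tendsto_of_le hs)

theorem countable_polyTimeReal : {r : ℝ | PolyTimeReal r}.Countable := by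
  rw [← Set.countable_coe_iff]
  choose M f p computes approx using fun r : {r : ℝ | PolyTimeReal r} => r.2
  refine Function.Injective.countable (f := M) fun r s hrs => ?_
  have f_eq : f r = f s := (hrs ▸ computes r).unique (computes s)
  exact Subtype.ext (eq_of_abs_sub_le_two_pow (approx r) (f_eq ▸ approx s))

theorem countable_amplitudes : Amplitudes.Countable := by
  have re_im_injective : Function.Injective fun z : ℂ => (z.re, z.im) := fun z w h =>
    Complex.ext (congrArg Prod.fst h) (congrArg Prod.snd h)
  exact (countable_polyTimeReal.prod countable_polyTimeReal).preimage re_im_injective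

instance : Countable QuantumMachine := by
  have _ : Countable Amplitudes := countable_amplitudes.to_subtype
  refine Function.Injective.countable
    (β := Σ F : Frame, (Fin F.states → F.Scan → F.Action → Amplitudes))
    (f := fun M => ⟨M.toFrame, fun q s a => ⟨M.amp q s a, M.amp_mem q s a⟩⟩) ?_
  rintro ⟨F, amp, _⟩ ⟨F', amp', _⟩ h
  obtain ⟨rfl, h⟩ := Sigma.mk.inj h
  obtain rfl : amp = amp' := by
    funext q s a
    exact congrArg Subtype.val (congrFun (congrFun (congrFun (eq_of_heq h) q) s) a)
  rfl

theorem QuantumMachine.ae_forall_isBigO :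
    ∀ᵐ π ∂randomPermutations, ∀ M : QuantumMachine, M.WellFormed →
      ∀ T : ℕ → ℕ, M.InvertsInTime π.oracle π.toFun T →
      (fun n : ℕ => (2 : ℝ) ^ ((n : ℝ) / 3)) =O[Filter.atTop] (fun n : ℕ => (T n : ℝ)) :=
  ae_all_iff.2 fun _ => Filter.eventually_imp_distrib_left.2 fun hM => hM.ae_isBigO

end Countability

/-! ### Evaluating the permutation with its oracle -/

section Writing

theorem wordTape_apply_eq_blank {a : ℤ} {w : List Bool} {z : ℤ} (hz : z < a ∨ a + w.length ≤ z) :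
    wordTape a w z = Sym.blank := by
  by_contra hne
  have := (wordTape_apply_ne_blank a w z).1 hne
  omega

theorem eq_wordTape {t : Tape} {a : ℤ} {w : List Bool}
    (inside : ∀ i (hi : i < w.length), t (a + i) = Sym.bit w[i])
    (outside : ∀ z, z < a ∨ a + w.length ≤ z → t z = Sym.blank) : t = wordTape a w := by
  ext z
  by_cases hz : a ≤ z ∧ z < a + w.length
  · obtain ⟨i, rfl⟩ := Int.le.dest hz.1
    have hi : i < w.length := by omega
    rw [inside i hi, wordTape_apply_add a w i hi]
  · have hz' : z < a ∨ a + w.length ≤ z := by omega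
    rw [outside z hz', wordTape_apply_eq_blank hz']

theorem wordTape_nil (a : ℤ) : wordTape a [] = 0 :=
  (eq_wordTape (fun _ hi => absurd hi (Nat.not_lt_zero _)) fun _ _ => rfl).symm

theorem update_wordTape_append (a : ℤ) (w : List Bool) (b : Bool) :
    (wordTape a w).update (a + w.length) (Sym.bit b) = wordTape a (w ++ [b]) := by
  refine eq_wordTape (fun i hi => ?_) fun z hz => ?_
  · rw [List.length_append, List.length_singleton] at hi
    obtain hi | rfl := Nat.lt_succ_iff_lt_or_eq.1 hi
    · rw [Finsupp.update_apply, if_neg (by omega), wordTape_apply_add a w i hi,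
        List.getElem_append_left hi]
    · simp
  · rw [List.length_append, List.length_singleton] at hz
    rw [Finsupp.update_apply, if_neg (by omega), wordTape_apply_eq_blank (by omega)]

theorem update_wordTape_last (a : ℤ) (w : List Bool) (b b' : Bool) :
    (wordTape a (w ++ [b])).update (a + w.length) (Sym.bit b') = wordTape a (w ++ [b']) := by
  rw [← update_wordTape_append a w b, Finsupp.update_idem, update_wordTape_append]

theorem update_wordTape_cons (a : ℤ) (w : List Bool) (b : Bool) :
    (wordTape a w).update (a - 1) (Sym.bit b) = wordTape (a - 1) (b :: w) := by
  refine eq_wordTape (fun i hi => ?_) fun z hz => ?_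
  · rw [Finsupp.update_apply]
    obtain _ | i := i
    · simp
    · rw [if_neg (by omega), show a - 1 + (i + 1 : ℕ) = a + i by omega,
        wordTape_apply_add a w i (by simpa using hi), List.getElem_cons_succ]
  · rw [List.length_cons] at hz
    rw [Finsupp.update_apply, if_neg (by omega), wordTape_apply_eq_blank (by omega)]

end Writing

/-- From `c` the machine gets to `c'` in `k` steps, without being in the final state before. -/
def DetMachine.Reaches (M : DetMachine) (A : Oracle) (c : Config M.toFrame) (k : ℕ)
    (c' : Config M.toFrame) : Prop :=
  (M.step A)^[k] c = c' ∧ ∀ s < k, ((M.step A)^[s] c).state ≠ M.final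

namespace DetMachine.Reaches

variable {M : DetMachine} {A : Oracle} {c c' c'' : Config M.toFrame} {k l : ℕ}

theorem refl (c : Config M.toFrame) : M.Reaches A c 0 c :=
  ⟨rfl, fun _ hs => absurd hs (Nat.not_lt_zero _)⟩

theorem trans (h : M.Reaches A c k c') (h' : M.Reaches A c' l c'') :
    M.Reaches A c (k + l) c'' := by
  have iterate_add (s : ℕ) : (M.step A)^[k + s] c = (M.step A)^[s] c' := by
    rw [add_comm, Function.iterate_add_apply, h.1]
  refine ⟨by rw [iterate_add, h'.1], fun s hs => ?_⟩
  obtain hsk | hks := lt_or_ge s k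
  · exact h.2 s hsk
  · obtain ⟨r, rfl⟩ := Nat.exists_eq_add_of_le hks
    rw [iterate_add]
    exact h'.2 r (Nat.lt_of_add_lt_add_left hs)

theorem single (hc : c.state ≠ M.final) (h : M.step A c = c') : M.Reaches A c 1 c' := by
  refine ⟨h, fun s hs => ?_⟩
  obtain rfl := Nat.lt_one_iff.1 hs
  exact hc

end DetMachine.Reaches

namespace Evaluator

/-- The states of a machine that evaluates a permutation `π` at `x`: it copies `x` to the query tape
as `0x0`, and then, in a round for each bit of `π x`, queries, moves the answer to the output tape
and prepends a `1` to the query. The input head counts the rounds on its way back over `x`. -/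
inductive State where
  | start | copy | round | query | answer | rewind | forward | final
  deriving DecidableEq

/-- The transition function of the evaluator, which never changes the input tape. -/
def transition (q : State) (s : Fin 3 → Sym) : State × (Fin 3 → Sym) × (Fin 3 → Move) :=
  match q with
  | .start => (.copy, ![s 0, .bit false, s 2], ![.stay, .right, .stay])
  | .copy =>
    if s 0 = .blank then (.round, ![s 0, .bit false, s 2], ![.left, .stay, .stay])
    else (.copy, ![s 0, s 0, s 2], ![.right, .right, .stay])
  | .round =>
    if s 0 = .blank then (.final, ![s 0, s 1, s 2], ![.stay, .stay, .stay])
    else (.query, ![s 0, s 1, s 2], ![.left, .stay, .stay])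
  | .answer => (.rewind, ![s 0, .bit false, s 1], ![.stay, .left, .right])
  | .rewind =>
    if s 1 = .blank then (.forward, ![s 0, .bit true, s 2], ![.stay, .right, .stay])
    else (.rewind, ![s 0, s 1, s 2], ![.stay, .left, .stay])
  | .forward =>
    if s 1 = .blank then (.round, ![s 0, s 1, s 2], ![.stay, .left, .stay])
    else (.forward, ![s 0, s 1, s 2], ![.stay, .right, .stay])
  | .query | .final => (.final, ![s 0, s 1, s 2], ![.stay, .stay, .stay])

/-- The numbering of the states, which `DetMachine` requires. -/
def code : State ≃ Fin 8 where
  toFun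
    | .start => 0
    | .copy => 1
    | .round => 2
    | .query => 3
    | .answer => 4
    | .rewind => 5
    | .forward => 6
    | .final => 7
  invFun := ![.start, .copy, .round, .query, .answer, .rewind, .forward, .final]
  left_inv q := by cases q <;> rfl
  right_inv := by decide

/-- The machine described at `State`. Its output tape is tape `2`, next to the query tape. -/
def machine : DetMachine where
  states := 8
  work := 1
  start := code .start
  final := code .final
  query := code .query
  answer := code .answer
  out := (2 : Fin 3)
  start_ne_final := by decide
  query_ne_answer := by decide
  delta q s := (transition (code.symm q) s).map code id

/-- A configuration of the evaluator, given tape by tape. -/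
def config (q : State) (t₀ t₁ t₂ : Tape) (h₀ h₁ h₂ : ℤ) : Config machine.toFrame where
  state := code q
  tape := (![t₀, t₁, t₂] : Fin 3 → Tape)
  head := (![h₀, h₁, h₂] : Fin 3 → ℤ)

variable {A : Oracle} {q q' : State} {t₀ t₁ t₂ : Tape} {h₀ h₁ h₂ : ℤ}

theorem scan_config :
    (config q t₀ t₁ t₂ h₀ h₁ h₂).scan = (![t₀ h₀, t₁ h₁, t₂ h₂] : Fin 3 → Sym) := by
  funext (j : Fin 3)
  fin_cases j <;> rfl

theorem act_config (s₁ s₂ : Sym) (m₀ m₁ m₂ : Move) :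
    (config q t₀ t₁ t₂ h₀ h₁ h₂).act (code q', (![t₀ h₀, s₁, s₂] : Fin 3 → Sym),
      (![m₀, m₁, m₂] : Fin 3 → Move)) =
    config q' t₀ (t₁.update h₁ s₁) (t₂.update h₂ s₂)
      (h₀ + m₀.shift) (h₁ + m₁.shift) (h₂ + m₂.shift) := by
  unfold Config.act config
  congr 1
  · funext (j : Fin 3)
    fin_cases j
    · exact Finsupp.update_self t₀ h₀
    all_goals rfl
  · funext (j : Fin 3)
    fin_cases j <;> rfl

theorem call_config (q : State) : (config q t₀ t₁ t₂ h₀ h₁ h₂).call A =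
    config .answer t₀ (callTape A t₁) t₂ h₀ h₁ h₂ := by
  unfold Config.call config
  congr 1
  funext (j : Fin 3)
  fin_cases j <;> rfl

theorem delta_code (q : State) (s : Fin 3 → Sym) :
    machine.delta (code q) s = (transition q s).map code id :=
  congrArg (fun q => (transition q s).map code id) (code.symm_apply_apply q)

theorem init_machine (x : List Bool) :
    Config.init machine.toFrame x = config .start (wordTape 0 x) 0 0 0 0 0 := by
  unfold Config.init config
  congr 1 <;>
  · funext (j : Fin 3)
    fin_cases j <;> rfl

theorem reaches_transition (t₀ t₁ t₂ : Tape) (h₀ h₁ h₂ : ℤ) {s₁ s₂ : Sym} {m₀ m₁ m₂ : Move}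
    (h : transition q ![t₀ h₀, t₁ h₁, t₂ h₂] = (q', ![t₀ h₀, s₁, s₂], ![m₀, m₁, m₂]))
    (hquery : q ≠ .query := by decide) (hfinal : q ≠ .final := by decide) :
    machine.Reaches A (config q t₀ t₁ t₂ h₀ h₁ h₂) 1
      (config q' t₀ (t₁.update h₁ s₁) (t₂.update h₂ s₂)
        (h₀ + m₀.shift) (h₁ + m₁.shift) (h₂ + m₂.shift)) :=
  .single (code.injective.ne hfinal) <|
    calc machine.step A (config q t₀ t₁ t₂ h₀ h₁ h₂)
        = (config q t₀ t₁ t₂ h₀ h₁ h₂).act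
            (machine.delta (code q) (config q t₀ t₁ t₂ h₀ h₁ h₂).scan) :=
          if_neg (code.injective.ne hquery)
      _ = (config q t₀ t₁ t₂ h₀ h₁ h₂).act
            ((transition q ![t₀ h₀, t₁ h₁, t₂ h₂]).map code id) := by
          rw [scan_config, delta_code]
          rfl
      _ = _ := by
          rw [h]
          exact act_config s₁ s₂ m₀ m₁ m₂

theorem reaches_start (t₀ t₁ t₂ : Tape) (h₀ h₁ h₂ : ℤ) :
    machine.Reaches A (config .start t₀ t₁ t₂ h₀ h₁ h₂) 1
      (config .copy t₀ (t₁.update h₁ (.bit false)) t₂ h₀ (h₁ + 1) h₂) := by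
  simpa [Move.shift] using reaches_transition (q := .start) t₀ t₁ t₂ h₀ h₁ h₂ rfl

theorem reaches_copy_of_ne_blank (h : t₀ h₀ ≠ .blank) (t₁ t₂ : Tape) (h₁ h₂ : ℤ) :
    machine.Reaches A (config .copy t₀ t₁ t₂ h₀ h₁ h₂) 1
      (config .copy t₀ (t₁.update h₁ (t₀ h₀)) t₂ (h₀ + 1) (h₁ + 1) h₂) := by
  simpa [Move.shift] using reaches_transition (q := .copy) t₀ t₁ t₂ h₀ h₁ h₂ (if_neg h)

theorem reaches_copy_of_eq_blank (h : t₀ h₀ = .blank) (t₁ t₂ : Tape) (h₁ h₂ : ℤ) :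
    machine.Reaches A (config .copy t₀ t₁ t₂ h₀ h₁ h₂) 1
      (config .round t₀ (t₁.update h₁ (.bit false)) t₂ (h₀ - 1) h₁ h₂) := by
  simpa [Move.shift, ← sub_eq_add_neg] using
    reaches_transition (q := .copy) t₀ t₁ t₂ h₀ h₁ h₂ (if_pos h)

theorem reaches_round_of_ne_blank (h : t₀ h₀ ≠ .blank) (t₁ t₂ : Tape) (h₁ h₂ : ℤ) :
    machine.Reaches A (config .round t₀ t₁ t₂ h₀ h₁ h₂) 1
      (config .query t₀ t₁ t₂ (h₀ - 1) h₁ h₂) := by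
  simpa [Move.shift, ← sub_eq_add_neg] using
    reaches_transition (q := .round) t₀ t₁ t₂ h₀ h₁ h₂ (if_neg h)

theorem reaches_round_of_eq_blank (h : t₀ h₀ = .blank) (t₁ t₂ : Tape) (h₁ h₂ : ℤ) :
    machine.Reaches A (config .round t₀ t₁ t₂ h₀ h₁ h₂) 1
      (config .final t₀ t₁ t₂ h₀ h₁ h₂) := by
  simpa [Move.shift] using reaches_transition (q := .round) t₀ t₁ t₂ h₀ h₁ h₂ (if_pos h)

theorem reaches_query (t₀ t₁ t₂ : Tape) (h₀ h₁ h₂ : ℤ) :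
    machine.Reaches A (config .query t₀ t₁ t₂ h₀ h₁ h₂) 1
      (config .answer t₀ (callTape A t₁) t₂ h₀ h₁ h₂) :=
  .single (code.injective.ne (by decide)) ((if_pos rfl).trans (call_config .query))

theorem reaches_answer (t₀ t₁ t₂ : Tape) (h₀ h₁ h₂ : ℤ) :
    machine.Reaches A (config .answer t₀ t₁ t₂ h₀ h₁ h₂) 1
      (config .rewind t₀ (t₁.update h₁ (.bit false)) (t₂.update h₂ (t₁ h₁))
        h₀ (h₁ - 1) (h₂ + 1)) := by
  simpa [Move.shift, ← sub_eq_add_neg] using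
    reaches_transition (q := .answer) t₀ t₁ t₂ h₀ h₁ h₂ rfl

theorem reaches_rewind_of_ne_blank (h : t₁ h₁ ≠ .blank) (t₀ t₂ : Tape) (h₀ h₂ : ℤ) :
    machine.Reaches A (config .rewind t₀ t₁ t₂ h₀ h₁ h₂) 1
      (config .rewind t₀ t₁ t₂ h₀ (h₁ - 1) h₂) := by
  simpa [Move.shift, ← sub_eq_add_neg] using
    reaches_transition (q := .rewind) t₀ t₁ t₂ h₀ h₁ h₂ (if_neg h)

theorem reaches_rewind_of_eq_blank (h : t₁ h₁ = .blank) (t₀ t₂ : Tape) (h₀ h₂ : ℤ) :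
    machine.Reaches A (config .rewind t₀ t₁ t₂ h₀ h₁ h₂) 1
      (config .forward t₀ (t₁.update h₁ (.bit true)) t₂ h₀ (h₁ + 1) h₂) := by
  simpa [Move.shift] using reaches_transition (q := .rewind) t₀ t₁ t₂ h₀ h₁ h₂ (if_pos h)

theorem reaches_forward_of_ne_blank (h : t₁ h₁ ≠ .blank) (t₀ t₂ : Tape) (h₀ h₂ : ℤ) :
    machine.Reaches A (config .forward t₀ t₁ t₂ h₀ h₁ h₂) 1
      (config .forward t₀ t₁ t₂ h₀ (h₁ + 1) h₂) := by
  simpa [Move.shift] using reaches_transition (q := .forward) t₀ t₁ t₂ h₀ h₁ h₂ (if_neg h)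

theorem reaches_forward_of_eq_blank (h : t₁ h₁ = .blank) (t₀ t₂ : Tape) (h₀ h₂ : ℤ) :
    machine.Reaches A (config .forward t₀ t₁ t₂ h₀ h₁ h₂) 1
      (config .round t₀ t₁ t₂ h₀ (h₁ - 1) h₂) := by
  simpa [Move.shift, ← sub_eq_add_neg] using
    reaches_transition (q := .forward) t₀ t₁ t₂ h₀ h₁ h₂ (if_pos h)

theorem reaches_rewind {k : ℕ} (h : ∀ j < k, t₁ (h₁ - j) ≠ .blank) (t₀ t₂ : Tape) (h₀ h₂ : ℤ) :
    machine.Reaches A (config .rewind t₀ t₁ t₂ h₀ h₁ h₂) k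
      (config .rewind t₀ t₁ t₂ h₀ (h₁ - k) h₂) := by
  induction k with
  | zero => simpa using DetMachine.Reaches.refl _
  | succ k ih =>
    rw [Nat.cast_succ, ← sub_sub]
    exact (ih fun j hj => h j (by omega)).trans
      (reaches_rewind_of_ne_blank (h k k.lt_succ_self) t₀ t₂ h₀ h₂)

theorem reaches_forward {k : ℕ} (h : ∀ j < k, t₁ (h₁ + j) ≠ .blank) (t₀ t₂ : Tape) (h₀ h₂ : ℤ) :
    machine.Reaches A (config .forward t₀ t₁ t₂ h₀ h₁ h₂) k
      (config .forward t₀ t₁ t₂ h₀ (h₁ + k) h₂) := by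
  induction k with
  | zero => simpa using DetMachine.Reaches.refl _
  | succ k ih =>
    rw [Nat.cast_succ, ← add_assoc]
    exact (ih fun j hj => h j (by omega)).trans
      (reaches_forward_of_ne_blank (h k k.lt_succ_self) t₀ t₂ h₀ h₂)

theorem reaches_copy (x : List Bool) {k : ℕ} (hk : k ≤ x.length) :
    machine.Reaches A (config .copy (wordTape 0 x) (wordTape 0 [false]) 0 0 1 0) k
      (config .copy (wordTape 0 x) (wordTape 0 (false :: x.take k)) 0 k (k + 1) 0) := by
  induction k with
  | zero => simpa using DetMachine.Reaches.refl _
  | succ k ih =>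
    have read : wordTape 0 x k = .bit x[k] := by simpa using wordTape_apply_add 0 x k hk
    have write : (wordTape 0 (false :: x.take k)).update (k + 1) (.bit x[k]) =
        wordTape 0 (false :: x.take (k + 1)) := by
      have length_take : ((false :: x.take k).length : ℤ) = k + 1 := by
        simp [Nat.le_of_succ_le hk]
      have h := update_wordTape_append 0 (false :: x.take k) x[k]
      rwa [length_take, zero_add, List.cons_append, List.take_concat_get' x k hk] at h
    have step := reaches_copy_of_ne_blank (A := A) (t₀ := wordTape 0 x) (h₀ := k) (by simp [read])
      (wordTape 0 (false :: x.take k)) 0 (k + 1) 0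
    rw [read, write] at step
    exact_mod_cast (ih (Nat.le_of_succ_le hk)).trans step

theorem reaches_prepend {a : ℤ} {v : List Bool} {k : ℕ} (hk : k ≤ v.length) (t₀ t₂ : Tape)
    (h₀ h₂ : ℤ) :
    machine.Reaches A (config .rewind t₀ (wordTape a v) t₂ h₀ (a + k - 1) h₂)
      (k + 1 + (v.length + 1))
      (config .round t₀ (wordTape (a - 1) (true :: v)) t₂ h₀ (a + v.length - 1) h₂) := by
  have rewind := reaches_rewind (A := A) (t₁ := wordTape a v) (h₁ := a + k - 1) (k := k)
    (fun j hj => (wordTape_apply_ne_blank a v _).2 (by omega)) t₀ t₂ h₀ h₂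
  rw [show a + k - 1 - (k : ℤ) = a - 1 by ring] at rewind
  have prepend := reaches_rewind_of_eq_blank (A := A) (t₁ := wordTape a v) (h₁ := a - 1)
    (wordTape_apply_eq_blank (by omega)) t₀ t₂ h₀ h₂
  rw [update_wordTape_cons, sub_add_cancel] at prepend
  have forward := reaches_forward (A := A) (t₁ := wordTape (a - 1) (true :: v)) (h₁ := a)
    (k := v.length)
    (fun j hj => (wordTape_apply_ne_blank _ _ _).2 (by simp only [List.length_cons]; omega))
    t₀ t₂ h₀ h₂
  have turn := reaches_forward_of_eq_blank (A := A) (t₁ := wordTape (a - 1) (true :: v))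
    (h₁ := a + v.length)
    (wordTape_apply_eq_blank (by simp only [List.length_cons]; omega)) t₀ t₂ h₀ h₂
  exact (rewind.trans prepend).trans (forward.trans turn)

theorem length_pair (x : List Bool) (i : ℕ) : (pair x i).length = x.length + i + 1 := by
  simp [pair]
  omega

theorem pair_succ (x : List Bool) (i : ℕ) : pair x (i + 1) = true :: pair x i := by
  simp [pair, List.replicate_succ]

/-- The configuration before the round for the bit of index `i` of `π x`. The word on the query tape
grows to the left, so that the answer always appears in cell `|x| + 1`. -/
noncomputable def roundConfig (π : Permutations) (x : List Bool) (i : ℕ) : Config machine.toFrame :=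
  config .round (wordTape 0 x) (wordTape (-i) (pair x i ++ [false]))
    (wordTape 0 ((π.toFun x).take i)) (x.length - 1 - i) (x.length + 1) i

variable (π : Permutations) (x : List Bool) {i : ℕ}

theorem reaches_answer_round (hi : i < x.length) :
    machine.Reaches π.oracle (roundConfig π x i) 3
      (config .rewind (wordTape 0 x) (wordTape (-i) (pair x i ++ [false]))
        (wordTape 0 ((π.toFun x).take (i + 1))) (x.length - 1 - (i + 1 : ℕ)) x.length
        (i + 1 : ℕ)) := by
  have hπ : i < (π.toFun x).length := by rwa [π.length_toFun]
  set b := (π.toFun x)[i]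
  have oracle_eq : π.oracle (pair x i) = b := by simp [oracle_pair, b, hπ]
  have last : -(i : ℤ) + (pair x i).length = x.length + 1 := by
    rw [length_pair]
    push_cast
    ring
  have read : wordTape (-i) (pair x i ++ [b]) (x.length + 1) = .bit b := by
    rw [← last, wordTape_apply_add _ _ _ (by simp)]
    simp
  have reset : (wordTape (-i) (pair x i ++ [b])).update (x.length + 1) (.bit false) =
      wordTape (-i) (pair x i ++ [false]) := by
    rw [← last, update_wordTape_last]
  have write : (wordTape 0 ((π.toFun x).take i)).update i (.bit b) =
      wordTape 0 ((π.toFun x).take (i + 1)) := by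
    simpa [min_eq_left hπ.le, b] using update_wordTape_append 0 ((π.toFun x).take i) b
  have start := reaches_round_of_ne_blank (A := π.oracle) (t₀ := wordTape 0 x)
    (h₀ := x.length - 1 - i) ((wordTape_apply_ne_blank _ _ _).2 (by omega))
    (wordTape (-i) (pair x i ++ [false])) (wordTape 0 ((π.toFun x).take i)) (x.length + 1) i
  have query := start.trans (reaches_query _ _ _ _ _ _)
  rw [callTape_wordTape, oracle_eq, Bool.false_xor] at query
  have answer := query.trans (reaches_answer _ _ _ _ _ _)
  rw [read, reset, write, add_sub_cancel_right,
    show (x.length : ℤ) - 1 - i - 1 = x.length - 1 - (i + 1 : ℕ) by omega] at answer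
  exact answer

theorem reaches_round (hi : i < x.length) :
    machine.Reaches π.oracle (roundConfig π x i) (2 * x.length + 2 * i + 8)
      (roundConfig π x (i + 1)) := by
  have length_query : (pair x i ++ [false]).length = x.length + i + 2 := by simp [length_pair]
  have prepend := reaches_prepend (A := π.oracle) (a := -i) (v := pair x i ++ [false])
    (k := x.length + i + 1) (by omega) (wordTape 0 x) (wordTape 0 ((π.toFun x).take (i + 1)))
    (x.length - 1 - (i + 1 : ℕ)) (i + 1 : ℕ)
  rw [length_query, ← List.cons_append, ← pair_succ,
    show -(i : ℤ) + (x.length + i + 1 : ℕ) - 1 = x.length by omega,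
    show -(i : ℤ) + (x.length + i + 2 : ℕ) - 1 = x.length + 1 by omega,
    show -(i : ℤ) - 1 = -(i + 1 : ℕ) by omega] at prepend
  rw [show 2 * x.length + 2 * i + 8 = 3 + (x.length + i + 1 + 1 + (x.length + i + 2 + 1)) by ring]
  exact (reaches_answer_round π x hi).trans prepend

theorem exists_reaches_roundConfig (hi : i ≤ x.length) :
    ∃ k ≤ i * (4 * x.length + 8),
      machine.Reaches π.oracle (roundConfig π x 0) k (roundConfig π x i) := by
  induction i with
  | zero => exact ⟨0, by simp, .refl _⟩
  | succ i ih =>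
    obtain ⟨k, hk, h⟩ := ih (Nat.le_of_succ_le hi)
    exact ⟨_, by nlinarith, h.trans (reaches_round π x hi)⟩

theorem reaches_roundConfig_zero :
    machine.Reaches π.oracle (Config.init machine.toFrame x) (x.length + 2)
      (roundConfig π x 0) := by
  have start := reaches_start (A := π.oracle) (wordTape 0 x) (wordTape 0 []) 0 0 0 0
  rw [show (wordTape 0 []).update 0 (.bit false) = wordTape 0 [false] by
    simpa using update_wordTape_append 0 [] false, wordTape_nil, zero_add] at start
  have copied := reaches_copy_of_eq_blank (A := π.oracle) (t₀ := wordTape 0 x) (h₀ := x.length)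
    (wordTape_apply_eq_blank (by omega)) (wordTape 0 (false :: x)) 0 (x.length + 1) 0
  rw [show (wordTape 0 (false :: x)).update (x.length + 1) (.bit false) =
    wordTape 0 (pair x 0 ++ [false]) by
      simpa [pair] using update_wordTape_append 0 (false :: x) false] at copied
  have copy := reaches_copy (A := π.oracle) x le_rfl
  rw [List.take_length] at copy
  rw [init_machine]
  convert (start.trans copy).trans copied using 1
  · omega
  · simp [roundConfig, wordTape_nil]

theorem computesInTime :
    machine.ComputesInTime π.oracle π.toFun fun n => n * (4 * n + 8) + n + 3 := by
  intro x
  obtain ⟨k, hk, rounds⟩ := exists_reaches_roundConfig π x le_rfl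
  have halt : machine.Reaches π.oracle (roundConfig π x x.length) 1 _ :=
    reaches_round_of_eq_blank (wordTape_apply_eq_blank (by omega)) _ _ _ _
  obtain ⟨run_eq, not_final⟩ := ((reaches_roundConfig_zero π x).trans rounds).trans halt
  refine ⟨x.length + 2 + k + 1, by dsimp only; omega, ⟨?_, not_final⟩, 0, ?_⟩
  · exact congrArg Config.state run_eq
  · refine (congrFun (congrArg Config.tape run_eq) machine.out).trans ?_
    change wordTape 0 _ = _
    rw [List.take_of_length_le (π.length_toFun x).le]

end Evaluator

end OracleTM

theorem corollary3p7 :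
    ∃ (C : OracleTM.DetMachine) (p : Polynomial ℕ),
      ∀ᵐ π ∂OracleTM.randomPermutations,
        Function.Bijective π.toFun ∧
        (∀ x : List Bool, (π.toFun x).length = x.length) ∧
        C.ComputesInTime π.oracle π.toFun (fun n => p.eval n) ∧
        ∀ M : OracleTM.QuantumMachine, M.WellFormed →
          ∀ T : ℕ → ℕ, M.InvertsInTime π.oracle π.toFun T →
            (fun n : ℕ => (2 : ℝ) ^ ((n : ℝ) / 3)) =O[Filter.atTop] (fun n : ℕ => (T n : ℝ)) := by
  refine ⟨OracleTM.Evaluator.machine, .X * (4 * .X + 8) + .X + 3, ?_⟩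
  filter_upwards [OracleTM.QuantumMachine.ae_forall_isBigO] with π hπ
  exact ⟨π.bijective_toFun, π.length_toFun,
    by simpa using OracleTM.Evaluator.computesInTime π, hπ⟩
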